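/- Let $g_0=dr^2+\sin^2 r\,d\theta^2$ be the standard metric of the unit sphere $S^2\subset\mathbb R^3$ in geodesic polar coordinates $(r,\theta)\mapsto(\sin r\cos\theta,\sin r\sin\theta,\cos r)$, let $n\ge 3$, and let $\mathbf I:S^2\to S^n$, $\mathbf I(x)=(x,0)$, be the standard totally geodesic embedding into the unit sphere $S^n\subset\mathbb R^{n+1}$. For $k=1,2,3,4$ let $\varphi_k$ be the rotationally symmetric map given in polar coordinates on source and target by $\varphi_k(r,\theta)=(\rho_k(r),\kappa_k\theta)$, and let $f_k$ be the function of $r$, as follows (with $\tau=\tan\frac r2$): - $k=1$: $\rho_1(r)=\frac12\arccos(\sin^2\frac r2)$, $\kappa_1=2$, $f_1=\dfrac{4(1+\tau^2)(1+2\tau^2)^{3/2}}{3\tau^4+9\tau^2+6+\tau^{-2}}$, $R_1=(0,\pi)$; - $k=2$: $\rho_2(r)=r$, $\kappa_2=\sqrt3$, $f_2=\left|\dfrac{\tau^{1+\sqrt3}(\tau^2+7+4\sqrt3)(\tau^2-2-\sqrt3)}{(1+\tau^2)^2(\tau^2-1)}\right|$, $R_2=(0,\pi)\setminus\{\frac\pi2,\,2\arctan\sqrt{2+\sqrt3}\}$;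 - $k=3$: $\rho_3(r)=r$, $\kappa_3=-\sqrt3$, $f_3=\left|\dfrac{\tau^{1-\sqrt3}(\tau^2+7-4\sqrt3)(\tau^2-2+\sqrt3)}{(1+\tau^2)^2(\tau^2-1)}\right|$, $R_3=(0,\pi)\setminus\{\frac\pi2,\,2\arctan\sqrt{2-\sqrt3}\}$; - $k=4$: $\rho_4(r)=r$, $\kappa_4=\frac12$, $f_4=\left|\dfrac{\tan r\,\sin(\frac{\sqrt3}2r)}{\sqrt{\sin r}}\right|$, $R_4=(0,\pi)\setminus\{\frac\pi2\}$. Then, for each $k=1,2,3,4$: 1. $f_k$ is smooth and positive on $R_k$, so that $f_k^{-1}g_0$ is a smooth Riemannian metric on $\{r\in R_k\}\subset S^2$. The other points of $S^2$ are singular points of this metric: for every $r_0\in[0,\pi]\setminus R_k$, $f_k(r)$ tends to $0$ or to $+\infty$ as $r\to r_0$ within $R_k$. 2. Let $U\subset S^2$ be any nonempty open set on which $r\in R_k$, with a determination $\theta:U\to\mathbb R$ of the polar angle, which is required to be continuous if $k\ne1$. (For $k=1$ the map $\varphi_1$ is independent of the choice of $\theta$, and one may take all of $U=S^2\setminus\{r=0,\pi\}$;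 for $k=2,3,4$, where $\kappa_k\notin\mathbb Z$, one may take for instance the points with $r\in R_k$ outside a half great circle joining the poles.) Then $\mathbf I\circ\varphi_k:(U,f_k^{-1}g_0)\to S^n$ is a proper biharmonic map, that is, it is smooth, its bitension field $$\tau_2(\phi)=\mathrm{Tr}_g(\nabla^\phi\nabla^\phi-\nabla^\phi_{\nabla^M})\tau(\phi)-\mathrm{Tr}_g R^{S^n}(d\phi,\tau(\phi))d\phi,\qquad \tau(\phi)=\mathrm{Tr}_g\nabla d\phi,$$ where $R^{S^n}(X,Y)Z=[\nabla_X,\nabla_Y]Z-\nabla_{[X,Y]}Z$, vanishes identically and its tension field $\tau(\phi)$ does not. Moreover $\mathbf I\circ\varphi_k$ is not weakly conformal on $U$: there is no function $\Lambda\ge0$ on $U$ such that the pull-back by $\mathbf I\circ\varphi_k$ of the standard metric of $S^n$ equals $\Lambda f_k^{-1}g_0$. -/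

import Mathlib

open Set Filter Topology
open scoped Manifold ContDiff InnerProductSpace

noncomputable section

namespace SphereMaps

/-- Euclidean space `ℝᵐ`. -/
abbrev Euc (m : ℕ) : Type := EuclideanSpace ℝ (Fin m)

/-- The unit sphere `Sⁿ ⊂ ℝⁿ⁺¹`, with Mathlib's smooth structure. -/
abbrev Sph (n : ℕ) : Type := Metric.sphere (0 : EuclideanSpace ℝ (Fin (n + 1))) 1

/-! ### Tension and bitension field in local coordinates

`G` is the matrix of a Riemannian metric in local coordinates `x¹, …, xᵐ`, and `Φ` is a map from the
coordinate domain to a unit sphere, regarded as a map into the surrounding inner product space `F`.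
A section of `Φ⁻¹ T Sⁿ` is a vector-valued function `V` with `V x ⊥ Φ x`. The Levi-Civita
connection of the sphere is the tangential part of the derivative in `F`. -/

section Coordinates

variable {m : ℕ} {F : Type*} [NormedAddCommGroup F] [InnerProductSpace ℝ F]

/-- The partial derivative `∂ᵢ u`. -/
def pd (i : Fin m) (u : Euc m → F) (x : Euc m) : F :=
  fderiv ℝ u x (EuclideanSpace.single i 1)

/-- The Christoffel symbol
`Γᵏᵢⱼ = ½ ∑ₗ gᵏˡ (∂ᵢ gⱼₗ + ∂ⱼ gᵢₗ - ∂ₗ gᵢⱼ)` of the metric `G`. -/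
def christoffel (G : Euc m → Matrix (Fin m) (Fin m) ℝ) (k i j : Fin m) (x : Euc m) : ℝ :=
  (1 / 2) * ∑ l, (G x)⁻¹ k l *
    (pd i (fun y => G y j l) x + pd j (fun y => G y i l) x - pd l (fun y => G y i j) x)

/-- The pull-back connection `∇^Φ_{∂ᵢ} V` of the unit sphere: the part of `∂ᵢ V` tangent to the
sphere at `Φ x`. -/
def nabla (Φ : Euc m → F) (i : Fin m) (V : Euc m → F) (x : Euc m) : F :=
  pd i V x - ⟪pd i V x, Φ x⟫_ℝ • Φ x

/-- The curvature operator `R(X, Y) Z = ⟨Y, Z⟩ X - ⟨X, Z⟩ Y` of the unit sphere, in the convention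
`R(X, Y) Z = [∇_X, ∇_Y] Z - ∇_[X, Y] Z`. -/
def sphereCurvature (X Y Z : F) : F := ⟪Y, Z⟫_ℝ • X - ⟪X, Z⟫_ℝ • Y

/-- The tension field
`τ(Φ) = Tr_g ∇dΦ = ∑ᵢⱼ gⁱʲ (∇^Φ_{∂ᵢ} ∂ⱼΦ - ∑ₖ Γᵏᵢⱼ ∂ₖΦ)`. -/
def tension (G : Euc m → Matrix (Fin m) (Fin m) ℝ) (Φ : Euc m → F) (x : Euc m) : F :=
  ∑ i, ∑ j, (G x)⁻¹ i j •
    (nabla Φ i (pd j Φ) x - ∑ k, christoffel G k i j x • pd k Φ x)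

/-- The rough Laplacian `Tr_g (∇^Φ ∇^Φ - ∇^Φ_{∇^M}) V` of a section `V` of `Φ⁻¹ T Sⁿ`. -/
def roughLaplacian (G : Euc m → Matrix (Fin m) (Fin m) ℝ) (Φ V : Euc m → F) (x : Euc m) : F :=
  ∑ i, ∑ j, (G x)⁻¹ i j •
    (nabla Φ i (nabla Φ j V) x - ∑ k, christoffel G k i j x • nabla Φ k V x)

/-- The bitension field
`τ₂(Φ) = Tr_g (∇^Φ ∇^Φ - ∇^Φ_{∇^M}) τ(Φ) - Tr_g R(dΦ, τ(Φ)) dΦ`. -/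
def bitension (G : Euc m → Matrix (Fin m) (Fin m) ℝ) (Φ : Euc m → F) (x : Euc m) : F :=
  roughLaplacian G Φ (tension G Φ) x -
    ∑ i, ∑ j, (G x)⁻¹ i j • sphereCurvature (pd i Φ x) (tension G Φ x) (pd j Φ x)

end Coordinates

/-! ### Harmonic, biharmonic and weakly conformal maps from a Riemannian manifold to a sphere -/

section Manifold

variable {m n : ℕ} {M : Type*} [TopologicalSpace M] [ChartedSpace (Euc m) M]

/-- A field of bilinear forms on the tangent spaces of `M` (used for Riemannian metrics that are
only defined on an open subset, with arbitrary values elsewhere). -/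
abbrev MetricField (m : ℕ) (M : Type*) [TopologicalSpace M] [ChartedSpace (Euc m) M] : Type _ :=
  (p : M) → TangentSpace (𝓡 m) p → TangentSpace (𝓡 m) p → ℝ

/-- The matrix `gᵢⱼ = g(∂ᵢ, ∂ⱼ)` of the metric `g` in the chart `e`. -/
def gram (g : MetricField m M) (e : OpenPartialHomeomorph M (Euc m)) (x : Euc m) :
    Matrix (Fin m) (Fin m) ℝ :=
  Matrix.of fun i j => g (e.symm x)
    (mfderiv (𝓡 m) (𝓡 m) e.symm x (EuclideanSpace.single i (1 : ℝ) : Euc m))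
    (mfderiv (𝓡 m) (𝓡 m) e.symm x (EuclideanSpace.single j (1 : ℝ) : Euc m))

/-- The expression of `φ : M → Sⁿ` in the chart `e`, as a map into `ℝⁿ⁺¹`. -/
def coordMap (φ : M → Sph n) (e : OpenPartialHomeomorph M (Euc m)) (x : Euc m) : Euc (n + 1) :=
  (φ (e.symm x) : Euc (n + 1))

/-- `φ : (U, g) → Sⁿ` is a harmonic map: it is smooth and its tension field vanishes identically
(in every smooth chart). -/
structure IsHarmonicOn (g : MetricField m M) (φ : M → Sph n) (U : Set M) : Prop where
  smooth : ContMDiffOn (𝓡 m) (𝓡 n) ∞ φ U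
  tension_eq_zero : ∀ e ∈ IsManifold.maximalAtlas (𝓡 m) ∞ M, ∀ x ∈ e.target, e.symm x ∈ U →
    tension (gram g e) (coordMap φ e) x = 0

/-- `φ : (U, g) → Sⁿ` is a biharmonic map: it is smooth and satisfies the biharmonic map equation,
i.e. its bitension field vanishes identically (in every smooth chart). -/
structure IsBiharmonicOn (g : MetricField m M) (φ : M → Sph n) (U : Set M) : Prop where
  smooth : ContMDiffOn (𝓡 m) (𝓡 n) ∞ φ U
  bitension_eq_zero : ∀ e ∈ IsManifold.maximalAtlas (𝓡 m) ∞ M, ∀ x ∈ e.target, e.symm x ∈ U →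
    bitension (gram g e) (coordMap φ e) x = 0

/-- A proper biharmonic map is a biharmonic map that is not harmonic. -/
def IsProperBiharmonicOn (g : MetricField m M) (φ : M → Sph n) (U : Set M) : Prop :=
  IsBiharmonicOn g φ U ∧ ¬ IsHarmonicOn g φ U

/-- `φ : (U, g) → Sⁿ` is weakly conformal: `φ^* h = Λ g` on `U` for a function `Λ ≥ 0`, where `h` is
the standard metric of `Sⁿ`. -/
def IsWeaklyConformalOn (g : MetricField m M) (φ : M → Sph n) (U : Set M) : Prop :=
  ∃ Λ : M → ℝ, ∀ p ∈ U, 0 ≤ Λ p ∧ ∀ v w : TangentSpace (𝓡 m) p,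
    ⟪mvfderiv (𝓡 m) (fun q => (φ q : Euc (n + 1))) p v,
      mvfderiv (𝓡 m) (fun q => (φ q : Euc (n + 1))) p w⟫_ℝ = Λ p * g p v w

end Manifold

/-! ### The round sphere, polar coordinates and conformal metrics -/

/-- The standard metric `g₀` on `Sᵐ`, induced from `ℝᵐ⁺¹`. -/
def roundMetric (m : ℕ) : MetricField m (Sph m) := fun p v w =>
  ⟪mvfderiv (𝓡 m) (fun q : Sph m => (q : Euc (m + 1))) p v,
    mvfderiv (𝓡 m) (fun q : Sph m => (q : Euc (m + 1))) p w⟫_ℝ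

/-- The point of `S²` with geodesic polar coordinates `(r, θ)`; here `g₀ = dr² + sin² r dθ²`. -/
def polar (r θ : ℝ) : Sph 2 :=
  ⟨!₂[Real.sin r * Real.cos θ, Real.sin r * Real.sin θ, Real.cos r], by
    rw [mem_sphere_zero_iff_norm, EuclideanSpace.norm_eq, Real.sqrt_eq_one]
    simp only [Fin.sum_univ_three, Real.norm_eq_abs, sq_abs]
    simp
    linear_combination Real.sin r ^ 2 * Real.sin_sq_add_cos_sq θ + Real.sin_sq_add_cos_sq r⟩

/-- The polar distance `r ∈ [0, π]` of a point of `S²` from the pole `(0, 0, 1)`. -/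
def colat (p : Sph 2) : ℝ := Real.arccos ((p : Euc 3) 2)

/-- The metric `f⁻¹ g₀` on `S²`, where `f = f(r)` is a function of the polar distance. -/
def conformalMetric (f : ℝ → ℝ) : MetricField 2 (Sph 2) := fun p v w =>
  (f (colat p))⁻¹ * roundMetric 2 p v w

/-- The standard totally geodesic embedding `S² → Sⁿ`, `x ↦ (x, 0)`, for `n ≥ 3`. -/
def stdEmbedding (n : ℕ) (hn : 3 ≤ n) (p : Sph 2) : Sph n :=
  ⟨WithLp.toLp 2 fun i : Fin (n + 1) =>
      if h : (i : ℕ) < 3 then (p : Euc 3) ⟨i, h⟩ else 0, by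
    have hp : ‖(p : Euc 3)‖ = 1 := mem_sphere_zero_iff_norm.1 p.2
    rw [EuclideanSpace.norm_eq, Real.sqrt_eq_one] at hp
    rw [mem_sphere_zero_iff_norm, EuclideanSpace.norm_eq, Real.sqrt_eq_one]
    refine Eq.trans ?_ hp
    symm
    have h3 : 3 ≤ n + 1 := by omega
    refine Fintype.sum_of_injective (Fin.castLE h3) (Fin.castLE_injective h3) _ _ ?_ ?_
    · intro i hi
      have : ¬ (i : ℕ) < 3 := fun h => hi ⟨⟨i, h⟩, by ext; simp⟩
      simp [this]
    · intro i
      simp⟩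

/-! ### The four maps -/

/-- The profile functions `ρₖ` of the four maps. -/
def profile : Fin 4 → ℝ → ℝ
  | 0 => fun r => (1 / 2) * Real.arccos (Real.sin (r / 2) ^ 2)
  | 1 => fun r => r
  | 2 => fun r => r
  | 3 => fun r => r

/-- The angular factors `κₖ` of the four maps. -/
def angularFactor : Fin 4 → ℝ
  | 0 => 2
  | 1 => √3
  | 2 => -√3
  | 3 => 1 / 2

/-- The functions `fₖ`. -/
def factor : Fin 4 → ℝ → ℝ
  | 0 => fun r =>
      4 * (1 + Real.tan (r / 2) ^ 2) * (1 + 2 * Real.tan (r / 2) ^ 2) ^ (3 / 2 : ℝ) /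
        (3 * Real.tan (r / 2) ^ 4 + 9 * Real.tan (r / 2) ^ 2 + 6 + Real.cot (r / 2) ^ 2)
  | 1 => fun r =>
      |Real.tan (r / 2) ^ (1 + √3 : ℝ) * (Real.tan (r / 2) ^ 2 + 7 + 4 * √3) *
          (Real.tan (r / 2) ^ 2 - 2 - √3) /
        ((1 + Real.tan (r / 2) ^ 2) ^ 2 * (Real.tan (r / 2) ^ 2 - 1))|
  | 2 => fun r =>
      |Real.tan (r / 2) ^ (1 - √3 : ℝ) * (Real.tan (r / 2) ^ 2 + 7 - 4 * √3) *
          (Real.tan (r / 2) ^ 2 - 2 + √3) /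
        ((1 + Real.tan (r / 2) ^ 2) ^ 2 * (Real.tan (r / 2) ^ 2 - 1))|
  | 3 => fun r => |Real.tan r * Real.sin (√3 / 2 * r) / √(Real.sin r)|

/-- The singular values of the polar distance strictly between the poles. -/
def singularRadii : Fin 4 → Set ℝ
  | 0 => ∅
  | 1 => {Real.pi / 2, 2 * Real.arctan (√(2 + √3))}
  | 2 => {Real.pi / 2, 2 * Real.arctan (√(2 - √3))}
  | 3 => {Real.pi / 2}

/-- The values of the polar distance at which `fₖ⁻¹ g₀` is a Riemannian metric. -/
def regularRadii (k : Fin 4) : Set ℝ := Ioo 0 Real.pi \ singularRadii k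

/-- The rotationally symmetric map `φₖ : (r, θ) ↦ (ρₖ(r), κₖ θ)` between 2-spheres, for a
determination `θ` of the polar angle. -/
def rotMap (k : Fin 4) (θ : Sph 2 → ℝ) (p : Sph 2) : Sph 2 :=
  polar (profile k (colat p)) (angularFactor k * θ p)

end SphereMaps

end

open SphereMaps

/-!
The metric is `g = f⁻¹ g₀` with `f = f(r)`. In dimension two a conformal change multiplies the
tension field by `f`, so a map `φ : (r, θ) ↦ (ρ(r), κ θ)` has tension field `f T ∂ρ` with `T =
ρ'' + cot r ρ' - κ² sin ρ cos ρ / sin² r`, and the bitension field of `φ` is `f` times the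
Jacobi operator of `φ : (S², g₀) → S²` applied to `u ∂ρ`, `u = f T`. This leaves the linear
equation `u'' + cot r u' = κ² cos 2ρ / sin² r · u` for `u`. The four functions `f` are such that
`u` solves it: with `τ = tan (r / 2)`, and up to sign, `u` is `2 (1 + τ²)` for the first map,
`τˢ (τ² + 7 + 4 s) (τ² - 2 - s) / (1 + τ²)²` with `s = ±√3` for the second and the third, and `¾
sin (√3 r / 2) / √(sin r)` for the fourth. In the variable `log τ` the operator `d²/dr² + cot r
d/dr` is the second derivative divided by `sin² r`, which makes the verification for the first
three maps a computation with Euler derivatives `τ d/dτ`.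

Since `T` has no zeros on the regular set, none of the maps is harmonic. Weak conformality at a
point would mean `ρ'² sin² r = κ² sin² ρ` there, which fails for every regular `r`.

The definitions quantify over all smooth charts. Rather than proving that the tension and
bitension fields are tensorial, the argument fixes a chart and writes the polar distance and a
local determination of the polar angle as functions of its coordinates. The metric matrix is
then `f⁻¹ (rᵢ rⱼ + sin² r θᵢ θⱼ)`, from which the traces of `dr` and `dθ` and the Laplacians of
`r` and `θ` (`IsPolarChart.trace_r_r`, `IsPolarChart.laplace_r` and their companions) follow by
algebra. Everything else is expressed through these and the frame of the image sphere
(`IsRotationalMap.tension_eq`, `IsRotationalMap.bitension_eq`). The composition with the totally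
geodesic embedding only replaces the standard basis of `ℝ³` by an orthonormal triple in `ℝⁿ⁺¹`.

The reduction is `IsBiharmonicProfile.isProperBiharmonicOn`; its hypotheses are verified in
`exists_isBiharmonicProfile`, and the limits of `f` at the singular radii are in
`tendsto_factor`.
-/

namespace SphereMaps

/-! ### Partial derivatives -/

section Calculus

variable {m : ℕ} {F : Type*} [NormedAddCommGroup F] [InnerProductSpace ℝ F]

lemma pd_congr {u v : Euc m → F} {x : Euc m} (h : u =ᶠ[𝓝 x] v) (i : Fin m) :
    pd i u x = pd i v x := by
  rw [pd, pd, h.fderiv_eq]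

lemma pd_comp {h : ℝ → ℝ} {h' : ℝ} {u : Euc m → ℝ} {x : Euc m} (hh : HasDerivAt h h' (u x))
    (hu : DifferentiableAt ℝ u x) (i : Fin m) : pd i (fun y => h (u y)) x = h' * pd i u x := by
  have := (hh.hasFDerivAt.comp x hu.hasFDerivAt).fderiv
  rw [pd, pd]
  change fderiv ℝ (h ∘ u) x _ = _
  rw [this]
  simp [mul_comm]

lemma pd_mul {u v : Euc m → ℝ} {x : Euc m} (hu : DifferentiableAt ℝ u x)
    (hv : DifferentiableAt ℝ v x) (i : Fin m) :
    pd i (fun y => u y * v y) x = pd i u x * v x + u x * pd i v x := by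
  rw [pd, pd, pd, fderiv_fun_mul hu hv]
  simp; ring

lemma pd_add {u v : Euc m → F} {x : Euc m} (hu : DifferentiableAt ℝ u x)
    (hv : DifferentiableAt ℝ v x) (i : Fin m) :
    pd i (fun y => u y + v y) x = pd i u x + pd i v x := by
  rw [pd, pd, pd, fderiv_fun_add hu hv]
  simp

lemma pd_smul {u : Euc m → ℝ} {v : Euc m → F} {x : Euc m} (hu : DifferentiableAt ℝ u x)
    (hv : DifferentiableAt ℝ v x) (i : Fin m) :
    pd i (fun y => u y • v y) x = pd i u x • v x + u x • pd i v x := by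
  rw [pd, pd, pd, fderiv_fun_smul hu hv]
  simp; abel

lemma pd_smul_const {u : Euc m → ℝ} {x : Euc m} (hu : DifferentiableAt ℝ u x) (a : F)
    (i : Fin m) : pd i (fun y => u y • a) x = pd i u x • a := by
  rw [pd, pd, fderiv_smul_const hu]
  simp

lemma differentiableAt_pd {u : Euc m → F} {x : Euc m} (hu : ContDiffAt ℝ ∞ u x) (i : Fin m) :
    DifferentiableAt ℝ (pd i u) x := by
  have h : DifferentiableAt ℝ (fderiv ℝ u) x :=
    ((hu.fderiv_right (m := 1) (by norm_cast)).differentiableAt (by norm_num))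
  exact h.clm_apply (differentiableAt_const _)

/-- Symmetry of the second derivative. -/
lemma pd_comm {u : Euc m → F} {x : Euc m} (hu : ContDiffAt ℝ ∞ u x) (i j : Fin m) :
    pd i (pd j u) x = pd j (pd i u) x := by
  have h : DifferentiableAt ℝ (fderiv ℝ u) x :=
    ((hu.fderiv_right (m := 1) (by norm_cast)).differentiableAt (by norm_num))
  have hs : IsSymmSndFDerivAt ℝ u x := hu.isSymmSndFDerivAt (by simp; norm_cast)
  have key : ∀ i j : Fin m, pd i (pd j u) x =
      fderiv ℝ (fderiv ℝ u) x (EuclideanSpace.single i 1) (EuclideanSpace.single j 1) := by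
    intro i j
    change fderiv ℝ (fun y => fderiv ℝ u y (EuclideanSpace.single j 1)) x _ = _
    rw [fderiv_clm_apply h (differentiableAt_const _)]
    simp
  rw [key, key, hs]

end Calculus

/-! ### Polar coordinates in an arbitrary chart -/

section PolarChart

/-- On the open set `W` of a coordinate domain, the functions `r` and `θ` are smooth local
coordinates in which the metric with matrix `G` is `lam(r) (dr² + sin² r dθ²)`. The original
coordinates are arbitrary; only their relation to `r` and `θ` is recorded. -/
structure IsPolarChart (G : Euc 2 → Matrix (Fin 2) (Fin 2) ℝ) (lam : ℝ → ℝ) (r θ : Euc 2 → ℝ)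
    (W : Set (Euc 2)) : Prop where
  isOpen : IsOpen W
  contDiffAt_r : ∀ y ∈ W, ContDiffAt ℝ ∞ r y
  contDiffAt_θ : ∀ y ∈ W, ContDiffAt ℝ ∞ θ y
  differentiableAt_lam : ∀ y ∈ W, DifferentiableAt ℝ lam (r y)
  lam_ne : ∀ y ∈ W, lam (r y) ≠ 0
  sin_ne : ∀ y ∈ W, Real.sin (r y) ≠ 0
  jac_ne : ∀ y ∈ W, pd 0 r y * pd 1 θ y - pd 1 r y * pd 0 θ y ≠ 0
  gram_eq : ∀ y ∈ W, ∀ i j, G y i j =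
    lam (r y) * (pd i r y * pd j r y + Real.sin (r y) ^ 2 * (pd i θ y * pd j θ y))

variable {G : Euc 2 → Matrix (Fin 2) (Fin 2) ℝ} {lam : ℝ → ℝ} {r θ : Euc 2 → ℝ} {W : Set (Euc 2)}

lemma IsPolarChart.inv_gram (h : IsPolarChart G lam r θ W) {y : Euc 2} (hy : y ∈ W) :
    (G y)⁻¹ = (lam (r y) * Real.sin (r y) ^ 2 *
        (pd 0 r y * pd 1 θ y - pd 1 r y * pd 0 θ y) ^ 2)⁻¹ •
      !![pd 1 r y ^ 2 + Real.sin (r y) ^ 2 * pd 1 θ y ^ 2,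
        -(pd 0 r y * pd 1 r y + Real.sin (r y) ^ 2 * (pd 0 θ y * pd 1 θ y));
        -(pd 0 r y * pd 1 r y + Real.sin (r y) ^ 2 * (pd 0 θ y * pd 1 θ y)),
        pd 0 r y ^ 2 + Real.sin (r y) ^ 2 * pd 0 θ y ^ 2] := by
  have h1 := h.lam_ne y hy
  have h2 := h.sin_ne y hy
  have h3 := h.jac_ne y hy
  have hG : G y = !![_, _; _, _] := Matrix.eta_fin_two (G y)
  rw [hG]
  simp only [h.gram_eq y hy]
  revert h1 h2 h3
  generalize pd 0 r y = a
  generalize pd 1 r y = b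
  generalize pd 0 θ y = c
  generalize pd 1 θ y = d
  generalize lam (r y) = l
  generalize Real.sin (r y) = s
  intro h1 h2 h3
  apply Matrix.inv_eq_right_inv
  ext i j
  have hq : (l * s ^ 2 * (a * d - b * c) ^ 2)⁻¹ * (l * s ^ 2 * (a * d - b * c) ^ 2) = 1 :=
    inv_mul_cancel₀ (by positivity)
  generalize (l * s ^ 2 * (a * d - b * c) ^ 2)⁻¹ = q at hq ⊢
  fin_cases i <;> fin_cases j <;> simp [Matrix.mul_apply] <;>
    first | ring1 | linear_combination hq

/-- This and the next three lemmas compute `Tr_g (dr ⊗ dr)`, `Tr_g (dr ⊗ dθ)`, `Tr_g (dθ ⊗ dr)` and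
`Tr_g (dθ ⊗ dθ)`. -/
lemma IsPolarChart.trace_r_r (h : IsPolarChart G lam r θ W) {y : Euc 2} (hy : y ∈ W) :
    ∑ i, ∑ j, (G y)⁻¹ i j * (pd i r y * pd j r y) = (lam (r y))⁻¹ := by
  have h1 := h.lam_ne y hy
  have h2 := h.sin_ne y hy
  have h3 := h.jac_ne y hy
  simp [Fin.sum_univ_two, h.inv_gram hy]
  field_simp
  ring

lemma IsPolarChart.trace_r_θ (h : IsPolarChart G lam r θ W) {y : Euc 2} (hy : y ∈ W) :
    ∑ i, ∑ j, (G y)⁻¹ i j * (pd i r y * pd j θ y) = 0 := by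
  simp [Fin.sum_univ_two, h.inv_gram hy]
  ring

lemma IsPolarChart.trace_θ_r (h : IsPolarChart G lam r θ W) {y : Euc 2} (hy : y ∈ W) :
    ∑ i, ∑ j, (G y)⁻¹ i j * (pd i θ y * pd j r y) = 0 := by
  simp [Fin.sum_univ_two, h.inv_gram hy]
  ring

lemma IsPolarChart.trace_θ_θ (h : IsPolarChart G lam r θ W) {y : Euc 2} (hy : y ∈ W) :
    ∑ i, ∑ j, (G y)⁻¹ i j * (pd i θ y * pd j θ y) = (lam (r y) * Real.sin (r y) ^ 2)⁻¹ := by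
  have h1 := h.lam_ne y hy
  have h2 := h.sin_ne y hy
  have h3 := h.jac_ne y hy
  simp [Fin.sum_univ_two, h.inv_gram hy]
  field_simp
  ring

lemma IsPolarChart.pd_gram (h : IsPolarChart G lam r θ W) {y : Euc 2} (hy : y ∈ W)
    (k i j : Fin 2) : pd k (fun z => G z i j) y =
      deriv lam (r y) * pd k r y *
          (pd i r y * pd j r y + Real.sin (r y) ^ 2 * (pd i θ y * pd j θ y)) +
        lam (r y) * (pd k (pd i r) y * pd j r y + pd i r y * pd k (pd j r) y +
          2 * Real.sin (r y) * Real.cos (r y) * pd k r y * (pd i θ y * pd j θ y) +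
          Real.sin (r y) ^ 2 * (pd k (pd i θ) y * pd j θ y + pd i θ y * pd k (pd j θ) y)) := by
  have hr := (h.contDiffAt_r y hy).differentiableAt (by simp)
  have hri := fun i => differentiableAt_pd (h.contDiffAt_r y hy) i
  have hti := fun i => differentiableAt_pd (h.contDiffAt_θ y hy) i
  have hl : HasDerivAt lam (deriv lam (r y)) (r y) := (h.differentiableAt_lam y hy).hasDerivAt
  have hs : HasDerivAt (fun t => Real.sin t ^ 2) (2 * Real.sin (r y) * Real.cos (r y)) (r y) := by
    simpa using! (Real.hasDerivAt_sin (r y)).pow 2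
  have hlr : DifferentiableAt ℝ (fun z => lam (r z)) y := hl.differentiableAt.comp y hr
  have hsr : DifferentiableAt ℝ (fun z => Real.sin (r z) ^ 2) y :=
    hs.differentiableAt.comp (f := r) y hr
  have hE : (fun z => G z i j) =ᶠ[𝓝 y] fun z =>
      lam (r z) * (pd i r z * pd j r z + Real.sin (r z) ^ 2 * (pd i θ z * pd j θ z)) := by
    filter_upwards [h.isOpen.mem_nhds hy] with z hz using h.gram_eq z hz i j
  have hrr := (hri i).fun_mul (hri j)
  have hss := hsr.fun_mul ((hti i).fun_mul (hti j))
  rw [pd_congr hE, pd_mul hlr (hrr.fun_add hss), pd_comp hl hr, pd_add hrr hss,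
    pd_mul (hri i) (hri j),
    pd_mul hsr ((hti i).fun_mul (hti j)), pd_comp hs hr, pd_mul (hti i) (hti j)]
  ring

/-- The Laplacian of `r`. The derivative of `lam` drops out, because the Laplacian in dimension two
is conformally covariant. -/
lemma IsPolarChart.laplace_r (h : IsPolarChart G lam r θ W) {y : Euc 2} (hy : y ∈ W) :
    ∑ i, ∑ j, (G y)⁻¹ i j * (pd i (pd j r) y - ∑ k, christoffel G k i j y * pd k r y) =
      (lam (r y))⁻¹ * (Real.cos (r y) / Real.sin (r y)) := by
  have h1 := h.lam_ne y hy
  have h2 := h.sin_ne y hy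
  have h3 := h.jac_ne y hy
  simp only [christoffel, h.pd_gram hy, h.inv_gram hy, Fin.sum_univ_two]
  rw [pd_comm (h.contDiffAt_r y hy) 1 0, pd_comm (h.contDiffAt_θ y hy) 1 0]
  simp
  field_simp
  ring

/-- The polar angle is a harmonic function. -/
lemma IsPolarChart.laplace_θ (h : IsPolarChart G lam r θ W) {y : Euc 2} (hy : y ∈ W) :
    ∑ i, ∑ j, (G y)⁻¹ i j * (pd i (pd j θ) y - ∑ k, christoffel G k i j y * pd k θ y) = 0 := by
  have h1 := h.lam_ne y hy
  have h2 := h.sin_ne y hy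
  have h3 := h.jac_ne y hy
  simp only [christoffel, h.pd_gram hy, h.inv_gram hy, Fin.sum_univ_two]
  rw [pd_comm (h.contDiffAt_r y hy) 1 0, pd_comm (h.contDiffAt_θ y hy) 1 0]
  simp
  field_simp
  ring

end PolarChart

/-! ### The moving frame along a rotationally symmetric map -/

section Frame

variable {F : Type*} [NormedAddCommGroup F] [InnerProductSpace ℝ F]

/-- The point with polar coordinates `(ρ, t)` on the 2-sphere spanned by the orthonormal triple
`a`, with pole `a 2`. -/
noncomputable def polarPoint (a : Fin 3 → F) (ρ t : ℝ) : F :=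
  (Real.sin ρ * Real.cos t) • a 0 + (Real.sin ρ * Real.sin t) • a 1 + Real.cos ρ • a 2

/-- The unit tangent vector `∂ρ` at `polarPoint a ρ t`. -/
noncomputable def polarRadial (a : Fin 3 → F) (ρ t : ℝ) : F :=
  (Real.cos ρ * Real.cos t) • a 0 + (Real.cos ρ * Real.sin t) • a 1 + (-Real.sin ρ) • a 2

/-- The unit tangent vector in the direction of `∂t` at `polarPoint a ρ t`; it does not depend on
`ρ`. -/
noncomputable def polarAngular (a : Fin 3 → F) (t : ℝ) : F :=
  (-Real.sin t) • a 0 + Real.cos t • a 1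

variable {a : Fin 3 → F}

lemma inner_combination (ha : Orthonormal ℝ a) (x₀ x₁ x₂ y₀ y₁ y₂ : ℝ) :
    ⟪x₀ • a 0 + x₁ • a 1 + x₂ • a 2, y₀ • a 0 + y₁ • a 1 + y₂ • a 2⟫_ℝ =
      x₀ * y₀ + x₁ * y₁ + x₂ * y₂ := by
  have h := orthonormal_iff_ite.1 ha
  simp only [inner_add_left, inner_add_right, real_inner_smul_left, real_inner_smul_right, h]
  simp
  ring

/-- `polarAngular` in the form to which `inner_combination` and `pd_combination` apply. -/
lemma polarAngular_eq (t : ℝ) :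
    polarAngular a t = (-Real.sin t) • a 0 + Real.cos t • a 1 + (0 : ℝ) • a 2 := by
  simp [polarAngular]

lemma inner_polarPoint_self (ha : Orthonormal ℝ a) (ρ t : ℝ) :
    ⟪polarPoint a ρ t, polarPoint a ρ t⟫_ℝ = 1 := by
  rw [polarPoint, inner_combination ha]
  linear_combination Real.sin ρ ^ 2 * Real.sin_sq_add_cos_sq t + Real.sin_sq_add_cos_sq ρ

lemma inner_polarRadial_self (ha : Orthonormal ℝ a) (ρ t : ℝ) :
    ⟪polarRadial a ρ t, polarRadial a ρ t⟫_ℝ = 1 := by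
  rw [polarRadial, inner_combination ha]
  linear_combination Real.cos ρ ^ 2 * Real.sin_sq_add_cos_sq t + Real.sin_sq_add_cos_sq ρ

lemma inner_polarAngular_self (ha : Orthonormal ℝ a) (t : ℝ) :
    ⟪polarAngular a t, polarAngular a t⟫_ℝ = 1 := by
  rw [polarAngular_eq, inner_combination ha]
  linear_combination Real.sin_sq_add_cos_sq t

lemma inner_polarRadial_polarAngular (ha : Orthonormal ℝ a) (ρ t : ℝ) :
    ⟪polarRadial a ρ t, polarAngular a t⟫_ℝ = 0 := by
  rw [polarRadial, polarAngular_eq, inner_combination ha]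
  ring

lemma inner_polarRadial_polarPoint (ha : Orthonormal ℝ a) (ρ t : ℝ) :
    ⟪polarRadial a ρ t, polarPoint a ρ t⟫_ℝ = 0 := by
  rw [polarRadial, polarPoint, inner_combination ha]
  linear_combination Real.sin ρ * Real.cos ρ * Real.sin_sq_add_cos_sq t

lemma inner_polarAngular_polarPoint (ha : Orthonormal ℝ a) (ρ t : ℝ) :
    ⟪polarAngular a t, polarPoint a ρ t⟫_ℝ = 0 := by
  rw [polarAngular_eq, polarPoint, inner_combination ha]
  ring

variable {m : ℕ} {p t : Euc m → ℝ} {x : Euc m}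

lemma differentiableAt_polarRadial (hp : DifferentiableAt ℝ p x) (ht : DifferentiableAt ℝ t x) :
    DifferentiableAt ℝ (fun y => polarRadial a (p y) (t y)) x := by
  unfold polarRadial
  fun_prop

lemma differentiableAt_polarAngular (ht : DifferentiableAt ℝ t x) :
    DifferentiableAt ℝ (fun y => polarAngular a (t y)) x := by
  unfold polarAngular
  fun_prop

lemma pd_sin (hp : DifferentiableAt ℝ p x) (i : Fin m) :
    pd i (fun y => Real.sin (p y)) x = Real.cos (p x) * pd i p x :=
  pd_comp (Real.hasDerivAt_sin _) hp i

lemma pd_cos (hp : DifferentiableAt ℝ p x) (i : Fin m) :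
    pd i (fun y => Real.cos (p y)) x = -Real.sin (p x) * pd i p x :=
  pd_comp (Real.hasDerivAt_cos _) hp i

lemma pd_neg {u : Euc m → ℝ} (i : Fin m) : pd i (fun y => -u y) x = -pd i u x := by
  simp [pd]

lemma pd_combination {u₀ u₁ u₂ : Euc m → ℝ} (h₀ : DifferentiableAt ℝ u₀ x)
    (h₁ : DifferentiableAt ℝ u₁ x) (h₂ : DifferentiableAt ℝ u₂ x) (i : Fin m) :
    pd i (fun y => u₀ y • a 0 + u₁ y • a 1 + u₂ y • a 2) x =
      pd i u₀ x • a 0 + pd i u₁ x • a 1 + pd i u₂ x • a 2 := by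
  rw [pd_add (by fun_prop) (by fun_prop), pd_add (by fun_prop) (by fun_prop),
    pd_smul_const h₀, pd_smul_const h₁, pd_smul_const h₂]

lemma pd_polarPoint (hp : DifferentiableAt ℝ p x) (ht : DifferentiableAt ℝ t x) (i : Fin m) :
    pd i (fun y => polarPoint a (p y) (t y)) x =
      pd i p x • polarRadial a (p x) (t x) +
        (Real.sin (p x) * pd i t x) • polarAngular a (t x) := by
  simp only [polarPoint]
  rw [pd_combination (by fun_prop) (by fun_prop) (by fun_prop),
    pd_mul (by fun_prop) (by fun_prop), pd_mul (by fun_prop) (by fun_prop), pd_sin hp, pd_sin ht,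
    pd_cos hp, pd_cos ht, polarRadial, polarAngular]
  module

lemma pd_polarRadial (hp : DifferentiableAt ℝ p x) (ht : DifferentiableAt ℝ t x) (i : Fin m) :
    pd i (fun y => polarRadial a (p y) (t y)) x =
      -pd i p x • polarPoint a (p x) (t x) +
        (Real.cos (p x) * pd i t x) • polarAngular a (t x) := by
  simp only [polarRadial]
  rw [pd_combination (by fun_prop) (by fun_prop) (by fun_prop),
    pd_mul (by fun_prop) (by fun_prop), pd_mul (by fun_prop) (by fun_prop), pd_neg, pd_sin hp,
    pd_sin ht, pd_cos hp, pd_cos ht, polarPoint, polarAngular]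
  module

/-- The derivative of the angular vector is decomposed along `polarPoint a ρ t` and `∂ρ` at an
arbitrary `ρ`, since the vector itself does not see `ρ`. -/
lemma pd_polarAngular (ht : DifferentiableAt ℝ t x) (ρ : ℝ) (i : Fin m) :
    pd i (fun y => polarAngular a (t y)) x =
      -pd i t x • (Real.sin ρ • polarPoint a ρ (t x) + Real.cos ρ • polarRadial a ρ (t x)) := by
  have e : Real.sin ρ • polarPoint a ρ (t x) + Real.cos ρ • polarRadial a ρ (t x) =
      (Real.sin ρ ^ 2 + Real.cos ρ ^ 2) • (Real.cos (t x) • a 0 + Real.sin (t x) • a 1) := by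
    rw [polarPoint, polarRadial]
    module
  rw [e, Real.sin_sq_add_cos_sq]
  simp only [polarAngular_eq]
  rw [pd_combination (by fun_prop) (by fun_prop) (by fun_prop), pd_neg, pd_sin ht, pd_cos ht]
  simp [pd]
  module

end Frame

section Rotational

variable {F : Type*} [NormedAddCommGroup F] [InnerProductSpace ℝ F] {a : Fin 3 → F}
  {G : Euc 2 → Matrix (Fin 2) (Fin 2) ℝ} {lam : ℝ → ℝ} {r θ : Euc 2 → ℝ} {W : Set (Euc 2)}
  {ρ ρ₁ ρ₂ u u₁ u₂ : ℝ → ℝ} {κ : ℝ} {Φ : Euc 2 → F}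

/-- In polar coordinates `(r, θ)` on `W` the map `Φ` is `(r, θ) ↦ (ρ(r), κ θ)`, with values in the
2-sphere of the orthonormal triple `a`; `ρ₁` is the derivative of the profile `ρ`. -/
structure IsRotationalMap (a : Fin 3 → F) (G : Euc 2 → Matrix (Fin 2) (Fin 2) ℝ) (lam : ℝ → ℝ)
    (r θ : Euc 2 → ℝ) (W : Set (Euc 2)) (ρ ρ₁ : ℝ → ℝ) (κ : ℝ) (Φ : Euc 2 → F) : Prop
    extends IsPolarChart G lam r θ W where
  orthonormal : Orthonormal ℝ a
  map_eq : ∀ y ∈ W, Φ y = polarPoint a (ρ (r y)) (κ * θ y)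
  deriv_profile : ∀ y ∈ W, HasDerivAt ρ (ρ₁ (r y)) (r y)

namespace IsRotationalMap

lemma differentiableAt_r (h : IsRotationalMap a G lam r θ W ρ ρ₁ κ Φ) {y : Euc 2} (hy : y ∈ W) :
    DifferentiableAt ℝ r y := (h.contDiffAt_r y hy).differentiableAt (by simp)

lemma differentiableAt_θ (h : IsRotationalMap a G lam r θ W ρ ρ₁ κ Φ) {y : Euc 2} (hy : y ∈ W) :
    DifferentiableAt ℝ (fun z => κ * θ z) y :=
  ((h.contDiffAt_θ y hy).differentiableAt (by simp)).const_mul κ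

lemma differentiableAt_profile (h : IsRotationalMap a G lam r θ W ρ ρ₁ κ Φ) {y : Euc 2}
    (hy : y ∈ W) : DifferentiableAt ℝ (fun z => ρ (r z)) y :=
  (h.deriv_profile y hy).differentiableAt.comp y (h.differentiableAt_r hy)

lemma pd_angle (h : IsRotationalMap a G lam r θ W ρ ρ₁ κ Φ) {y : Euc 2} (hy : y ∈ W)
    (i : Fin 2) : pd i (fun z => κ * θ z) y = κ * pd i θ y := by
  rw [pd, pd, fderiv_const_mul ((h.contDiffAt_θ y hy).differentiableAt (by simp))]
  simp

lemma pd_map (h : IsRotationalMap a G lam r θ W ρ ρ₁ κ Φ) {y : Euc 2} (hy : y ∈ W) (i : Fin 2) :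
    pd i Φ y = (ρ₁ (r y) * pd i r y) • polarRadial a (ρ (r y)) (κ * θ y) +
      (Real.sin (ρ (r y)) * (κ * pd i θ y)) • polarAngular a (κ * θ y) := by
  have hE : Φ =ᶠ[𝓝 y] fun z => polarPoint a (ρ (r z)) (κ * θ z) := by
    filter_upwards [h.isOpen.mem_nhds hy] with z hz using h.map_eq z hz
  rw [pd_congr hE, pd_polarPoint (h.differentiableAt_profile hy) (h.differentiableAt_θ hy),
    h.pd_angle hy, pd_comp (h.deriv_profile y hy) (h.differentiableAt_r hy)]

lemma inner_pd_map (h : IsRotationalMap a G lam r θ W ρ ρ₁ κ Φ) {y : Euc 2} (hy : y ∈ W)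
    (i j : Fin 2) : ⟪pd i Φ y, pd j Φ y⟫_ℝ = ρ₁ (r y) ^ 2 * (pd i r y * pd j r y) +
      κ ^ 2 * Real.sin (ρ (r y)) ^ 2 * (pd i θ y * pd j θ y) := by
  rw [h.pd_map hy, h.pd_map hy]
  simp only [inner_add_left, inner_add_right, real_inner_smul_left, real_inner_smul_right,
    inner_polarRadial_self h.orthonormal, inner_polarAngular_self h.orthonormal,
    inner_polarRadial_polarAngular h.orthonormal,
    real_inner_comm (polarRadial a _ _) (polarAngular a _)]
  ring

/-- The pull-back connection in the frame `∂ρ`, `∂t` of the image: `∇ᵢ ∂ρ = κ cos ρ θᵢ N` and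
`∇ᵢ N = -κ cos ρ θᵢ ∂ρ`, where `N` is the unit angular vector. -/
lemma nabla_combination (h : IsRotationalMap a G lam r θ W ρ ρ₁ κ Φ) {y : Euc 2} (hy : y ∈ W)
    {A B : Euc 2 → ℝ} (hA : DifferentiableAt ℝ A y) (hB : DifferentiableAt ℝ B y)
    {V : Euc 2 → F} (hV : ∀ z ∈ W, V z = A z • polarRadial a (ρ (r z)) (κ * θ z) +
      B z • polarAngular a (κ * θ z)) (i : Fin 2) :
    nabla Φ i V y =
      (pd i A y - B y * (κ * Real.cos (ρ (r y)) * pd i θ y)) •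
          polarRadial a (ρ (r y)) (κ * θ y) +
        (pd i B y + A y * (κ * Real.cos (ρ (r y)) * pd i θ y)) • polarAngular a (κ * θ y) := by
  have hp := h.differentiableAt_profile hy
  have ht := h.differentiableAt_θ hy
  have hE : V =ᶠ[𝓝 y] fun z => A z • polarRadial a (ρ (r z)) (κ * θ z) +
      B z • polarAngular a (κ * θ z) := by
    filter_upwards [h.isOpen.mem_nhds hy] with z hz using hV z hz
  have hR := differentiableAt_polarRadial (a := a) hp ht
  have hN := differentiableAt_polarAngular (a := a) ht
  have hpd : pd i V y = (pd i A y - B y * (κ * Real.cos (ρ (r y)) * pd i θ y)) •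
          polarRadial a (ρ (r y)) (κ * θ y) +
        (pd i B y + A y * (κ * Real.cos (ρ (r y)) * pd i θ y)) • polarAngular a (κ * θ y) -
        (A y * pd i (fun z => ρ (r z)) y + B y * (κ * pd i θ y) * Real.sin (ρ (r y))) •
          polarPoint a (ρ (r y)) (κ * θ y) := by
    rw [pd_congr hE, pd_add (hA.fun_smul hR) (hB.fun_smul hN), pd_smul hA hR, pd_smul hB hN,
      pd_polarRadial hp ht, pd_polarAngular ht (ρ (r y)), h.pd_angle hy]
    module
  rw [nabla, hpd, h.map_eq y hy]
  simp only [inner_add_left, inner_sub_left, real_inner_smul_left,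
    inner_polarPoint_self h.orthonormal, inner_polarRadial_polarPoint h.orthonormal,
    inner_polarAngular_polarPoint h.orthonormal]
  module

end IsRotationalMap

end Rotational

/-! ### The tension and bitension fields of a rotationally symmetric map -/

section Bitension

variable {F : Type*} [NormedAddCommGroup F] [InnerProductSpace ℝ F] {a : Fin 3 → F}
  {G : Euc 2 → Matrix (Fin 2) (Fin 2) ℝ} {lam : ℝ → ℝ} {r θ : Euc 2 → ℝ} {W : Set (Euc 2)}
  {ρ ρ₁ ρ₂ u u₁ u₂ : ℝ → ℝ} {κ : ℝ} {Φ : Euc 2 → F}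

/-- A trace of vectors that lie in the span of `E` and `N`, computed on coefficients. -/
lemma sum_smul_combination {g : Matrix (Fin 2) (Fin 2) ℝ} {X Y : Fin 2 → Fin 2 → ℝ}
    {V : Fin 2 → Fin 2 → F} {E N : F}
    {x y : ℝ} (hV : ∀ i j, V i j = X i j • E + Y i j • N)
    (hX : ∑ i, ∑ j, g i j * X i j = x) (hY : ∑ i, ∑ j, g i j * Y i j = y) :
    ∑ i, ∑ j, g i j • V i j = x • E + y • N := by
  simp only [hV, smul_add, smul_smul, Finset.sum_add_distrib, ← Finset.sum_smul, hX, hY]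

namespace IsRotationalMap

/-- `τ(Φ) = f (ρ'' + cot r ρ' - κ² sin ρ cos ρ / sin² r) ∂ρ` for the metric `f⁻¹ g₀`. -/
lemma tension_eq (h : IsRotationalMap a G lam r θ W ρ ρ₁ κ Φ)
    (hρ₂ : ∀ y ∈ W, HasDerivAt ρ₁ (ρ₂ (r y)) (r y)) {y : Euc 2} (hy : y ∈ W) :
    tension G Φ y = ((lam (r y))⁻¹ * (ρ₂ (r y) + Real.cos (r y) / Real.sin (r y) * ρ₁ (r y) -
        κ ^ 2 * (Real.sin (ρ (r y)) * Real.cos (ρ (r y))) / Real.sin (r y) ^ 2)) •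
      polarRadial a (ρ (r y)) (κ * θ y) := by
  have hr := h.differentiableAt_r hy
  have hp := h.differentiableAt_profile hy
  have hri := fun i => differentiableAt_pd (h.contDiffAt_r y hy) i
  have hti := fun i => differentiableAt_pd (h.contDiffAt_θ y hy) i
  have hρr : DifferentiableAt ℝ (fun z => ρ₁ (r z)) y := (hρ₂ y hy).differentiableAt.comp y hr
  have hN : ∀ i j, nabla Φ i (pd j Φ) y - ∑ k, christoffel G k i j y • pd k Φ y =
      (ρ₂ (r y) * (pd i r y * pd j r y) - κ ^ 2 * (Real.sin (ρ (r y)) * Real.cos (ρ (r y))) *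
          (pd i θ y * pd j θ y) +
        ρ₁ (r y) * (pd i (pd j r) y - ∑ k, christoffel G k i j y * pd k r y)) •
          polarRadial a (ρ (r y)) (κ * θ y) +
      (κ * Real.cos (ρ (r y)) * ρ₁ (r y) * (pd i r y * pd j θ y + pd i θ y * pd j r y) +
        κ * Real.sin (ρ (r y)) * (pd i (pd j θ) y - ∑ k, christoffel G k i j y * pd k θ y)) •
          polarAngular a (κ * θ y) := by
    intro i j
    rw [h.nabla_combination hy (hρr.fun_mul (hri j))
      (hp.sin.fun_mul ((hti j).const_mul κ)) (fun z hz => h.pd_map hz j)]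
    have hκ : pd i (fun z => κ * pd j θ z) y = κ * pd i (pd j θ) y := by
      rw [pd, pd, fderiv_const_mul (hti j)]
      simp
    rw [pd_mul hρr (hri j), pd_mul hp.sin ((hti j).const_mul κ), pd_comp (hρ₂ y hy) hr,
      pd_sin hp, pd_comp (h.deriv_profile y hy) hr, hκ]
    simp only [Fin.sum_univ_two, h.pd_map hy]
    module
  have t1 := h.trace_r_r hy
  have t2 := h.trace_r_θ hy
  have t3 := h.trace_θ_r hy
  have t4 := h.trace_θ_θ hy
  have t5 := h.laplace_r hy
  have t6 := h.laplace_θ hy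
  rw [tension, sum_smul_combination hN rfl (y := 0)]
  · rw [zero_smul, add_zero]
    congr 1
    simp only [mul_inv] at t4
    rw [div_eq_mul_inv _ (Real.sin (r y) ^ 2)]
    generalize (Real.sin (r y) ^ 2)⁻¹ = s at *
    simp only [Fin.sum_univ_two] at *
    linear_combination ρ₂ (r y) * t1 -
      κ ^ 2 * (Real.sin (ρ (r y)) * Real.cos (ρ (r y))) * t4 + ρ₁ (r y) * t5
  · simp only [Fin.sum_univ_two] at *
    linear_combination κ * Real.cos (ρ (r y)) * ρ₁ (r y) * (t2 + t3) +
      κ * Real.sin (ρ (r y)) * t6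

/-- If `τ(Φ) = u(r) ∂ρ`, then `τ₂(Φ) = f (u'' + cot r u' - κ² cos 2ρ / sin² r u) ∂ρ`: the
connection contributes `-κ² cos² ρ / sin² r u` and the curvature `κ² sin² ρ / sin² r u`. -/
lemma bitension_eq (h : IsRotationalMap a G lam r θ W ρ ρ₁ κ Φ)
    (hτ : ∀ y ∈ W, tension G Φ y = u (r y) • polarRadial a (ρ (r y)) (κ * θ y))
    (hu : ∀ y ∈ W, HasDerivAt u (u₁ (r y)) (r y))
    (hu₁ : ∀ y ∈ W, HasDerivAt u₁ (u₂ (r y)) (r y)) {y : Euc 2} (hy : y ∈ W) :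
    bitension G Φ y = ((lam (r y))⁻¹ * (u₂ (r y) + Real.cos (r y) / Real.sin (r y) * u₁ (r y) -
        κ ^ 2 * Real.cos (2 * ρ (r y)) / Real.sin (r y) ^ 2 * u (r y))) •
      polarRadial a (ρ (r y)) (κ * θ y) := by
  have hr := h.differentiableAt_r hy
  have hp := h.differentiableAt_profile hy
  have hri := fun i => differentiableAt_pd (h.contDiffAt_r y hy) i
  have hti := fun i => differentiableAt_pd (h.contDiffAt_θ y hy) i
  have hur : ∀ z ∈ W, DifferentiableAt ℝ (fun z => u (r z)) z := fun z hz =>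
    (hu z hz).differentiableAt.comp z (h.differentiableAt_r hz)
  have hu₁r : DifferentiableAt ℝ (fun z => u₁ (r z)) y := (hu₁ y hy).differentiableAt.comp y hr
  have hn : ∀ z ∈ W, ∀ i, nabla Φ i (tension G Φ) z =
      (u₁ (r z) * pd i r z) • polarRadial a (ρ (r z)) (κ * θ z) +
        (u (r z) * Real.cos (ρ (r z)) * (κ * pd i θ z)) • polarAngular a (κ * θ z) := by
    intro z hz i
    rw [h.nabla_combination (A := fun z => u (r z)) (B := fun _ => 0) hz (hur z hz)
      (differentiableAt_const _) (fun w hw => by simp [hτ w hw]),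
      pd_comp (hu z hz) (h.differentiableAt_r hz)]
    simp only [pd, fderiv_fun_const]
    simp
    ring_nf
  have hL : ∀ i j, nabla Φ i (nabla Φ j (tension G Φ)) y -
        ∑ k, christoffel G k i j y • nabla Φ k (tension G Φ) y =
      (u₂ (r y) * (pd i r y * pd j r y) -
          κ ^ 2 * Real.cos (ρ (r y)) ^ 2 * u (r y) * (pd i θ y * pd j θ y) +
        u₁ (r y) * (pd i (pd j r) y - ∑ k, christoffel G k i j y * pd k r y)) •
          polarRadial a (ρ (r y)) (κ * θ y) +
      (κ * (u₁ (r y) * Real.cos (ρ (r y)) - u (r y) * Real.sin (ρ (r y)) * ρ₁ (r y)) *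
          (pd i r y * pd j θ y) + κ * Real.cos (ρ (r y)) * u₁ (r y) * (pd i θ y * pd j r y) +
        κ * Real.cos (ρ (r y)) * u (r y) *
          (pd i (pd j θ) y - ∑ k, christoffel G k i j y * pd k θ y)) •
          polarAngular a (κ * θ y) := by
    intro i j
    rw [h.nabla_combination hy (hu₁r.fun_mul (hri j))
      (((hur y hy).fun_mul hp.cos).fun_mul ((hti j).const_mul κ)) (fun z hz => hn z hz j)]
    have hκ : pd i (fun z => κ * pd j θ z) y = κ * pd i (pd j θ) y := by
      rw [pd, pd, fderiv_const_mul (hti j)]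
      simp
    rw [pd_mul hu₁r (hri j), pd_mul ((hur y hy).fun_mul hp.cos) ((hti j).const_mul κ),
      pd_mul (hur y hy) hp.cos, pd_comp (hu₁ y hy) hr, pd_comp (hu y hy) hr, pd_cos hp,
      pd_comp (h.deriv_profile y hy) hr, hκ]
    simp only [Fin.sum_univ_two, hn y hy]
    module
  have hR : ∀ i j, sphereCurvature (pd i Φ y) (tension G Φ y) (pd j Φ y) =
      (-(κ ^ 2 * Real.sin (ρ (r y)) ^ 2 * u (r y)) * (pd i θ y * pd j θ y)) •
          polarRadial a (ρ (r y)) (κ * θ y) +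
      (κ * Real.sin (ρ (r y)) * u (r y) * ρ₁ (r y) * (pd i θ y * pd j r y)) •
          polarAngular a (κ * θ y) := by
    intro i j
    rw [sphereCurvature, h.inner_pd_map hy, hτ y hy, h.pd_map hy, h.pd_map hy]
    simp only [inner_add_right, real_inner_smul_left, real_inner_smul_right,
      inner_polarRadial_self h.orthonormal, inner_polarRadial_polarAngular h.orthonormal]
    module
  have t1 := h.trace_r_r hy
  have t2 := h.trace_r_θ hy
  have t3 := h.trace_θ_r hy
  have t4 := h.trace_θ_θ hy
  have t5 := h.laplace_r hy
  have t6 := h.laplace_θ hy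
  rw [bitension, roughLaplacian, sum_smul_combination hL rfl (y := 0),
    sum_smul_combination hR rfl (y := 0)]
  · rw [zero_smul, add_zero, add_zero, ← sub_smul, Real.cos_two_mul']
    congr 1
    simp only [mul_inv] at t4
    rw [div_eq_mul_inv _ (Real.sin (r y) ^ 2)]
    generalize (Real.sin (r y) ^ 2)⁻¹ = s at *
    simp only [Fin.sum_univ_two] at *
    linear_combination u₂ (r y) * t1 + u₁ (r y) * t5 -
      κ ^ 2 * (Real.cos (ρ (r y)) ^ 2 - Real.sin (ρ (r y)) ^ 2) * u (r y) * t4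
  · simp only [Fin.sum_univ_two] at *
    linear_combination κ * Real.sin (ρ (r y)) * u (r y) * ρ₁ (r y) * t3
  · simp only [Fin.sum_univ_two] at *
    linear_combination κ * (u₁ (r y) * Real.cos (ρ (r y)) -
      u (r y) * Real.sin (ρ (r y)) * ρ₁ (r y)) * t2 + κ * Real.cos (ρ (r y)) * u₁ (r y) * t3 +
      κ * Real.cos (ρ (r y)) * u (r y) * t6

/-- Where `Φ` is weakly conformal, the stretching factors `|ρ'|` along the meridians and
`|κ sin ρ / sin r|` along the circles of latitude agree. -/
lemma stretch_eq_of_inner_pd_eq (h : IsRotationalMap a G lam r θ W ρ ρ₁ κ Φ) {y : Euc 2}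
    (hy : y ∈ W) {c : ℝ} (hc : ∀ i j, ⟪pd i Φ y, pd j Φ y⟫_ℝ = c * G y i j) :
    ρ₁ (r y) ^ 2 * Real.sin (r y) ^ 2 = κ ^ 2 * Real.sin (ρ (r y)) ^ 2 := by
  have key : ∀ i j, (ρ₁ (r y) ^ 2 - c * lam (r y)) * (pd i r y * pd j r y) +
      (κ ^ 2 * Real.sin (ρ (r y)) ^ 2 - c * lam (r y) * Real.sin (r y) ^ 2) *
        (pd i θ y * pd j θ y) = 0 := by
    intro i j
    have := hc i j
    rw [h.inner_pd_map hy, h.gram_eq y hy] at this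
    linear_combination this
  have k00 := key 0 0
  have k01 := key 0 1
  have k11 := key 1 1
  have hJ := h.jac_ne y hy
  have e1 : ρ₁ (r y) ^ 2 - c * lam (r y) = 0 := by
    refine (mul_eq_zero.1 ?_).resolve_right (pow_ne_zero 2 hJ)
    linear_combination pd 1 θ y ^ 2 * k00 - 2 * pd 0 θ y * pd 1 θ y * k01 + pd 0 θ y ^ 2 * k11
  have e2 : κ ^ 2 * Real.sin (ρ (r y)) ^ 2 - c * lam (r y) * Real.sin (r y) ^ 2 = 0 := by
    refine (mul_eq_zero.1 ?_).resolve_right (pow_ne_zero 2 hJ)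
    linear_combination pd 1 r y ^ 2 * k00 - 2 * pd 0 r y * pd 1 r y * k01 + pd 0 r y ^ 2 * k11
  linear_combination Real.sin (r y) ^ 2 * e1 - e2

end IsRotationalMap

end Bitension

/-! ### Local determinations of the polar angle -/

section Angle

/-- The component of `q` in the direction of the half-plane of longitude `θ₀`. -/
noncomputable def meridianPart (θ₀ : ℝ) (q : Euc 3) : ℝ := q 0 * Real.cos θ₀ + q 1 * Real.sin θ₀

/-- The determination of the polar angle with values within `π / 2` of `θ₀`. It is smooth on the
half-space where `meridianPart θ₀` is positive; elsewhere the value is meaningless. -/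
noncomputable def angleNear (θ₀ : ℝ) (q : Euc 3) : ℝ :=
  θ₀ + Real.arctan ((q 1 * Real.cos θ₀ - q 0 * Real.sin θ₀) / meridianPart θ₀ q)

lemma contDiff_meridianPart (θ₀ : ℝ) : ContDiff ℝ ∞ (meridianPart θ₀) := by
  unfold meridianPart
  fun_prop

lemma contDiffAt_angleNear {θ₀ : ℝ} {q : Euc 3} (hq : 0 < meridianPart θ₀ q) :
    ContDiffAt ℝ ∞ (angleNear θ₀) q := by
  unfold angleNear
  have h1 : ContDiffAt ℝ ∞ (fun q : Euc 3 =>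
      (q 1 * Real.cos θ₀ - q 0 * Real.sin θ₀) / meridianPart θ₀ q) q :=
    ContDiffAt.div (by fun_prop) (contDiff_meridianPart θ₀).contDiffAt hq.ne'
  exact contDiffAt_const.add (Real.contDiff_arctan.contDiffAt.comp q h1)

lemma sum_sq_sphere (p : Sph 2) :
    (p : Euc 3) 0 ^ 2 + (p : Euc 3) 1 ^ 2 + (p : Euc 3) 2 ^ 2 = 1 := by
  have hp : ‖(p : Euc 3)‖ = 1 := mem_sphere_zero_iff_norm.1 p.2
  rw [EuclideanSpace.norm_eq, Real.sqrt_eq_one] at hp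
  simpa [Fin.sum_univ_three] using hp

lemma cos_colat (p : Sph 2) : Real.cos (colat p) = (p : Euc 3) 2 := by
  have := sum_sq_sphere p
  apply Real.cos_arccos <;> nlinarith [sq_nonneg ((p : Euc 3) 0), sq_nonneg ((p : Euc 3) 1)]

lemma continuous_colat : Continuous colat := by
  unfold colat
  fun_prop

lemma coe_polar_zero (r t : ℝ) : (polar r t : Euc 3) 0 = Real.sin r * Real.cos t := by
  simp [polar]

lemma coe_polar_one (r t : ℝ) : (polar r t : Euc 3) 1 = Real.sin r * Real.sin t := by
  simp [polar]

lemma coe_polar_two (r t : ℝ) : (polar r t : Euc 3) 2 = Real.cos r := by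
  simp [polar]

lemma meridianPart_polar (r t : ℝ) : meridianPart t (polar r t : Euc 3) = Real.sin r := by
  rw [meridianPart, coe_polar_zero, coe_polar_one]
  linear_combination Real.sin r * Real.sin_sq_add_cos_sq t

lemma angleNear_mem (θ₀ : ℝ) (q : Euc 3) : |angleNear θ₀ q - θ₀| < Real.pi := by
  have h1 := Real.arctan_lt_pi_div_two
    ((q 1 * Real.cos θ₀ - q 0 * Real.sin θ₀) / meridianPart θ₀ q)
  have h2 := Real.neg_pi_div_two_lt_arctan
    ((q 1 * Real.cos θ₀ - q 0 * Real.sin θ₀) / meridianPart θ₀ q)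
  rw [angleNear, add_sub_cancel_left, abs_lt]
  constructor <;> linarith [Real.pi_pos]

lemma polar_angleNear {θ₀ : ℝ} {p : Sph 2} (hp : 0 < meridianPart θ₀ p)
    (hc : colat p ∈ Ioo 0 Real.pi) : polar (colat p) (angleNear θ₀ p) = p := by
  have hs : 0 < Real.sin (colat p) := Real.sin_pos_of_mem_Ioo hc
  set x := (p : Euc 3) 0
  set y := (p : Euc 3) 1
  set b := y * Real.cos θ₀ - x * Real.sin θ₀ with hb
  have hmp : meridianPart θ₀ p = x * Real.cos θ₀ + y * Real.sin θ₀ := rfl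
  have hab : meridianPart θ₀ p ^ 2 + b ^ 2 = Real.sin (colat p) ^ 2 := by
    rw [Real.sin_sq, cos_colat]
    rw [hmp, hb]
    linear_combination (x ^ 2 + y ^ 2) * Real.sin_sq_add_cos_sq θ₀ + sum_sq_sphere p
  have hsq : √(1 + (b / meridianPart θ₀ p) ^ 2) = Real.sin (colat p) / meridianPart θ₀ p := by
    rw [Real.sqrt_eq_iff_mul_self_eq (by positivity) (by positivity), ← sq, div_pow, div_pow, ← hab]
    field_simp
  have hcos : Real.cos (Real.arctan (b / meridianPart θ₀ p)) =
      meridianPart θ₀ p / Real.sin (colat p) := by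
    rw [Real.cos_arctan, hsq, one_div_div]
  have hsin : Real.sin (Real.arctan (b / meridianPart θ₀ p)) = b / Real.sin (colat p) := by
    rw [Real.sin_arctan, hsq]
    field_simp
  have hang : angleNear θ₀ p = θ₀ + Real.arctan (b / meridianPart θ₀ p) := rfl
  ext i
  fin_cases i
  · change (polar _ _ : Euc 3) 0 = x
    rw [coe_polar_zero, hang, Real.cos_add, hcos, hsin]
    field_simp
    rw [hmp, hb]
    linear_combination x * Real.sin_sq_add_cos_sq θ₀
  · change (polar _ _ : Euc 3) 1 = y
    rw [coe_polar_one, hang, Real.sin_add, hcos, hsin]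
    field_simp
    rw [hmp, hb]
    linear_combination y * Real.sin_sq_add_cos_sq θ₀
  · change (polar _ _ : Euc 3) 2 = (p : Euc 3) 2
    rw [coe_polar_two, cos_colat]

lemma contDiffAt_colat {p : Sph 2} (hc : colat p ∈ Ioo 0 Real.pi) :
    ContDiffAt ℝ ∞ (fun q : Euc 3 => Real.arccos (q 2)) (p : Euc 3) := by
  have hs : 0 < Real.sin (colat p) := Real.sin_pos_of_mem_Ioo hc
  have h1 := Real.sin_sq_add_cos_sq (colat p)
  rw [cos_colat] at h1
  have h2 : ContDiffAt ℝ ∞ (fun q : Euc 3 => q 2) (p : Euc 3) := by fun_prop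
  exact (Real.contDiffAt_arccos (by intro h; rw [h] at h1; nlinarith)
    (by intro h; rw [h] at h1; nlinarith)).comp (p : Euc 3) h2

end Angle

/-! ### Polar coordinates on the standard spheres -/

section Frames

/-- The first three vectors of the standard basis of `ℝᵐ`. -/
noncomputable def stdFrame {m : ℕ} (hm : 3 ≤ m) (i : Fin 3) : Euc m :=
  EuclideanSpace.single (Fin.castLE hm i) 1

lemma orthonormal_stdFrame {m : ℕ} (hm : 3 ≤ m) : Orthonormal ℝ (stdFrame hm) :=
  EuclideanSpace.orthonormal_single.comp _ (Fin.castLE_injective hm)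

lemma coe_polar (r t : ℝ) : (polar r t : Euc 3) = polarPoint (stdFrame le_rfl) r t := by
  ext i
  fin_cases i <;> simp [polar, polarPoint, stdFrame]

lemma coe_stdEmbedding_polar (n : ℕ) (hn : 3 ≤ n) (r t : ℝ) :
    (stdEmbedding n hn (polar r t) : Euc (n + 1)) =
      polarPoint (stdFrame (Nat.le_succ_of_le hn)) r t := by
  ext i
  by_cases h : (i : ℕ) < 3
  · obtain ⟨i, hi⟩ := i
    change i < 3 at h
    interval_cases i <;>
      simp [stdEmbedding, polar, polarPoint, stdFrame, Fin.ext_iff]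
  · have h0 : (i : ℕ) ≠ 0 := by omega
    have h1 : (i : ℕ) ≠ 1 := by omega
    have h2 : (i : ℕ) ≠ 2 := by omega
    simp [stdEmbedding, polarPoint, stdFrame, h, Fin.ext_iff, h0, h1, h2]

end Frames

/-! ### Smooth charts of the 2-sphere -/

section Charts

variable {e : OpenPartialHomeomorph (Sph 2) (Euc 2)}

lemma contMDiff_coe (n : ℕ) :
    ContMDiff (𝓡 n) 𝓘(ℝ, Euc (n + 1)) ∞ (fun q : Sph n => (q : Euc (n + 1))) := by
  have := Fact.mk (finrank_euclideanSpace_fin (𝕜 := ℝ) (n := n + 1))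
  exact contMDiff_coe_sphere

lemma mdifferentiableAt_coe {n : ℕ} (p : Sph n) :
    MDifferentiableAt (𝓡 n) 𝓘(ℝ, Euc (n + 1)) (fun q : Sph n => (q : Euc (n + 1))) p :=
  (contMDiff_coe n p).mdifferentiableAt (by simp)

lemma injective_mvfderiv_coe {n : ℕ} (p : Sph n) :
    Function.Injective (mvfderiv (𝓡 n) (fun q : Sph n => (q : Euc (n + 1))) p) := by
  have := Fact.mk (finrank_euclideanSpace_fin (𝕜 := ℝ) (n := n + 1))
  exact injective_mvfderiv_subtypeVal_sphere p

lemma contDiffAt_coordinates (he : e ∈ IsManifold.maximalAtlas (𝓡 2) ∞ (Sph 2)) {x : Euc 2}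
    (hx : x ∈ e.target) : ContDiffAt ℝ ∞ (fun y => (e.symm y : Euc 3)) x := by
  rw [← contMDiffAt_iff_contDiffAt]
  exact (contMDiff_coe 2 (e.symm x)).comp x (contMDiffAt_symm_of_mem_maximalAtlas he hx)

lemma mem_maximalAtlas_one (he : e ∈ IsManifold.maximalAtlas (𝓡 2) ∞ (Sph 2)) :
    e ∈ IsManifold.maximalAtlas (𝓡 2) 1 (Sph 2) :=
  IsManifold.maximalAtlas_subset_of_le (by norm_cast) he

lemma mvfderiv_comp_chart_symm {m : ℕ} (he : e ∈ IsManifold.maximalAtlas (𝓡 2) ∞ (Sph 2))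
    {φ : Sph 2 → Euc m} {x : Euc 2} (hx : x ∈ e.target)
    (hφ : MDifferentiableAt (𝓡 2) 𝓘(ℝ, Euc m) φ (e.symm x)) (v : Euc 2) :
    mvfderiv (𝓡 2) φ (e.symm x) (mfderiv (𝓡 2) (𝓡 2) e.symm x v) =
      fderiv ℝ (fun y => φ (e.symm y)) x v := by
  have h1 := mdifferentiableAt_symm_of_mem_maximalAtlas (mem_maximalAtlas_one he) hx
  have h2 := mfderiv_comp x hφ h1
  rw [← mfderiv_eq_fderiv]
  change _ = mfderiv (𝓡 2) 𝓘(ℝ, Euc m) (φ ∘ e.symm) x v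
  rw [h2]
  rfl

lemma injective_fderiv_coordinates (he : e ∈ IsManifold.maximalAtlas (𝓡 2) ∞ (Sph 2)) {x : Euc 2}
    (hx : x ∈ e.target) : Function.Injective (fderiv ℝ (fun y => (e.symm y : Euc 3)) x) := by
  have hd : e.MDifferentiable (𝓡 2) (𝓡 2) :=
    ⟨fun y hy => (mdifferentiableAt_of_mem_maximalAtlas (mem_maximalAtlas_one he)
      hy).mdifferentiableWithinAt, fun y hy => (mdifferentiableAt_symm_of_mem_maximalAtlas
      (mem_maximalAtlas_one he) hy).mdifferentiableWithinAt⟩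
  have h1 := hd.symm.mfderiv_injective hx
  have h2 := injective_mvfderiv_coe (e.symm x)
  intro v w hvw
  have hc : MDifferentiableAt (𝓡 2) 𝓘(ℝ, Euc 3) (fun q : Sph 2 => (q : Euc 3)) (e.symm x) :=
    mdifferentiableAt_coe (e.symm x)
  rw [← mvfderiv_comp_chart_symm he hx hc, ← mvfderiv_comp_chart_symm he hx hc] at hvw
  exact h1 (h2 hvw)

/-- In any chart the conformal metric is `f⁻¹` times the first fundamental form of the inclusion of
`S²` in `ℝ³`. -/
lemma gram_conformalMetric (he : e ∈ IsManifold.maximalAtlas (𝓡 2) ∞ (Sph 2)) {x : Euc 2}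
    (hx : x ∈ e.target) (f : ℝ → ℝ) (i j : Fin 2) :
    gram (conformalMetric f) e x i j = (f (colat (e.symm x)))⁻¹ *
      ⟪pd i (fun y => (e.symm y : Euc 3)) x, pd j (fun y => (e.symm y : Euc 3)) x⟫_ℝ := by
  have hc : MDifferentiableAt (𝓡 2) 𝓘(ℝ, Euc 3) (fun q : Sph 2 => (q : Euc 3)) (e.symm x) :=
    mdifferentiableAt_coe (e.symm x)
  rw [gram, Matrix.of_apply, conformalMetric, roundMetric, pd, pd,
    mvfderiv_comp_chart_symm he hx hc, mvfderiv_comp_chart_symm he hx hc]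

/-- A map into a sphere is smooth if it is smooth as a map into the ambient Euclidean space. -/
lemma contMDiffAt_of_coe {n : ℕ} {φ : Sph 2 → Sph n} {O : Set (Sph 2)} (hO : IsOpen O)
    (h : ContMDiffOn (𝓡 2) 𝓘(ℝ, Euc (n + 1)) ∞ (fun q => (φ q : Euc (n + 1))) O) {p : Sph 2}
    (hp : p ∈ O) : ContMDiffAt (𝓡 2) (𝓡 n) ∞ φ p := by
  let O' : TopologicalSpace.Opens (Sph 2) := ⟨O, hO⟩
  have h1 : ContMDiff (𝓡 2) 𝓘(ℝ, Euc (n + 1)) ∞ (fun q : O' => (φ q : Euc (n + 1))) := fun q =>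
    (contMDiffAt_subtype_iff (f := fun q => (φ q : Euc (n + 1)))).2
      (h.contMDiffAt (hO.mem_nhds q.2))
  have := Fact.mk (finrank_euclideanSpace_fin (𝕜 := ℝ) (n := n + 1))
  have h2 : ContMDiff (𝓡 2) (𝓡 n) ∞ (fun q : O' => φ q) :=
    h1.codRestrict_sphere (n := n) (fun q => (φ q).2)
  exact contMDiffAt_subtype_iff.1 (h2 (⟨p, hp⟩ : O'))

end Charts

/-! ### Reduction to an ordinary differential equation -/

section ChartRotational

variable {e : OpenPartialHomeomorph (Sph 2) (Euc 2)}

/-- On the open set `O` of points with longitude near `θ₀` and polar distance in `R`, the map `φ` is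
`(r, θ) ↦ (ρ(r), κ θ)` for the smooth determination `angleNear θ₀` of the polar angle. -/
structure IsRotationalOn (ρ : ℝ → ℝ) (κ : ℝ) (φ : Sph 2 → Sph 2) (R : Set ℝ) (θ₀ : ℝ)
    (O : Set (Sph 2)) : Prop where
  isOpen : IsOpen O
  colat_mem : ∀ q ∈ O, colat q ∈ R
  meridianPart_pos : ∀ q ∈ O, 0 < meridianPart θ₀ q
  map_eq : ∀ q ∈ O, φ q = polar (ρ (colat q)) (κ * angleNear θ₀ q)

variable {ρ ρ₁ ρ₂ f : ℝ → ℝ} {κ θ₀ : ℝ} {φ : Sph 2 → Sph 2} {R : Set ℝ} {O : Set (Sph 2)}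

/-- In an arbitrary smooth chart of `S²`, the functions `colat` and `angleNear θ₀` are polar
coordinates for the conformal metric. -/
lemma isPolarChart_conformalMetric (he : e ∈ IsManifold.maximalAtlas (𝓡 2) ∞ (Sph 2))
    (hRo : IsOpen R) (hR : R ⊆ Ioo 0 Real.pi) (hf : ContDiffOn ℝ ∞ f R) (hf0 : ∀ r ∈ R, 0 < f r)
    (hO : IsRotationalOn ρ κ φ R θ₀ O) :
    IsPolarChart (gram (conformalMetric f) e) (fun t => (f t)⁻¹) (fun y => colat (e.symm y))
      (fun y => angleNear θ₀ (e.symm y)) (e.target ∩ e.symm ⁻¹' O) := by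
  have hW : IsOpen (e.target ∩ e.symm ⁻¹' O) := e.isOpen_inter_preimage_symm hO.isOpen
  have hr : ∀ y ∈ e.target ∩ e.symm ⁻¹' O, ContDiffAt ℝ ∞ (fun y => colat (e.symm y)) y := by
    rintro y ⟨hy, hyO⟩
    exact ContDiffAt.comp (g := fun q : Euc 3 => Real.arccos (q 2)) y
      (contDiffAt_colat (hR (hO.colat_mem _ hyO))) (contDiffAt_coordinates he hy)
  have hθ : ∀ y ∈ e.target ∩ e.symm ⁻¹' O,
      ContDiffAt ℝ ∞ (fun y => angleNear θ₀ (e.symm y)) y := by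
    rintro y ⟨hy, hyO⟩
    exact ContDiffAt.comp (g := angleNear θ₀) y
      (contDiffAt_angleNear (hO.meridianPart_pos _ hyO)) (contDiffAt_coordinates he hy)
  have hpd : ∀ y ∈ e.target ∩ e.symm ⁻¹' O, ∀ i, pd i (fun z => (e.symm z : Euc 3)) y =
      pd i (fun y => colat (e.symm y)) y •
          polarRadial (stdFrame le_rfl) (colat (e.symm y)) (angleNear θ₀ (e.symm y)) +
        (Real.sin (colat (e.symm y)) * pd i (fun y => angleNear θ₀ (e.symm y)) y) •
          polarAngular (stdFrame le_rfl) (angleNear θ₀ (e.symm y)) := by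
    intro y hy i
    have hE : (fun z => (e.symm z : Euc 3)) =ᶠ[𝓝 y] fun z =>
        polarPoint (stdFrame le_rfl) (colat (e.symm z)) (angleNear θ₀ (e.symm z)) := by
      filter_upwards [hW.mem_nhds hy] with z hz
      rw [← coe_polar, polar_angleNear (hO.meridianPart_pos _ hz.2) (hR (hO.colat_mem _ hz.2))]
    rw [pd_congr hE, pd_polarPoint ((hr y hy).differentiableAt (by simp))
      ((hθ y hy).differentiableAt (by simp))]
  refine ⟨hW, hr, hθ, ?_, ?_, ?_, ?_, ?_⟩
  · rintro y ⟨hy, hyO⟩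
    have hc := hO.colat_mem _ hyO
    exact ((hf.contDiffAt (hRo.mem_nhds hc)).differentiableAt (by simp)).fun_inv (hf0 _ hc).ne'
  · rintro y ⟨hy, hyO⟩
    exact inv_ne_zero (hf0 _ (hO.colat_mem _ hyO)).ne'
  · rintro y ⟨hy, hyO⟩
    exact (Real.sin_pos_of_mem_Ioo (hR (hO.colat_mem _ hyO))).ne'
  · -- a linear relation between `dr` and `dθ` would give a vector in the kernel of `d e.symm`
    rintro y hy hJ
    have hinj := injective_fderiv_coordinates he hy.1
    have hv : ∀ a b : ℝ, a • pd 0 (fun z => (e.symm z : Euc 3)) y +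
        b • pd 1 (fun z => (e.symm z : Euc 3)) y = 0 → a = 0 ∧ b = 0 := by
      intro a b hab
      rw [pd, pd, ← map_smul, ← map_smul, ← map_add] at hab
      have h0 := hinj (hab.trans (map_zero _).symm)
      have e0 := congrArg (fun v : Euc 2 => v 0) h0
      have e1 := congrArg (fun v : Euc 2 => v 1) h0
      simp at e0 e1
      exact ⟨e0, e1⟩
    simp only [hpd y hy] at hv
    set r₀ := pd 0 (fun y => colat (e.symm y)) y
    set r₁ := pd 1 (fun y => colat (e.symm y)) y
    set t₀ := pd 0 (fun y => angleNear θ₀ (e.symm y)) y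
    set t₁ := pd 1 (fun y => angleNear θ₀ (e.symm y)) y
    have h1 := hv r₁ (-r₀) (by
      rw [show ∀ E N : Euc 3, ∀ s : ℝ, r₁ • (r₀ • E + (s * t₀) • N) +
        (-r₀) • (r₁ • E + (s * t₁) • N) = (-s * (r₀ * t₁ - r₁ * t₀)) • N by intros; module, hJ]
      simp)
    have h2 := hv t₁ (-t₀) (by
      rw [show ∀ E N : Euc 3, ∀ s : ℝ, t₁ • (r₀ • E + (s * t₀) • N) +
        (-t₀) • (r₁ • E + (s * t₁) • N) = (r₀ * t₁ - r₁ * t₀) • E by intros; module, hJ]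
      simp)
    have h3 := hv 1 0 (by
      rw [neg_eq_zero.1 h1.2, neg_eq_zero.1 h2.2]
      simp)
    exact one_ne_zero h3.1
  · intro y hy i j
    rw [gram_conformalMetric he hy.1, hpd y hy, hpd y hy]
    have ho := orthonormal_stdFrame (m := 3) le_rfl
    simp only [inner_add_left, inner_add_right, real_inner_smul_left, real_inner_smul_right,
      inner_polarRadial_self ho, inner_polarAngular_self ho, inner_polarRadial_polarAngular ho,
      real_inner_comm (polarRadial (stdFrame le_rfl) _ _) (polarAngular (stdFrame le_rfl) _)]
    ring

lemma isRotationalMap_coordMap (n : ℕ) (hn : 3 ≤ n)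
    (he : e ∈ IsManifold.maximalAtlas (𝓡 2) ∞ (Sph 2))
    (hRo : IsOpen R) (hR : R ⊆ Ioo 0 Real.pi) (hf : ContDiffOn ℝ ∞ f R) (hf0 : ∀ r ∈ R, 0 < f r)
    (hρ : ∀ r ∈ R, HasDerivAt ρ (ρ₁ r) r) (hO : IsRotationalOn ρ κ φ R θ₀ O) :
    IsRotationalMap (stdFrame (Nat.le_succ_of_le hn)) (gram (conformalMetric f) e)
      (fun t => (f t)⁻¹) (fun y => colat (e.symm y)) (fun y => angleNear θ₀ (e.symm y))
      (e.target ∩ e.symm ⁻¹' O) ρ ρ₁ κ (coordMap (stdEmbedding n hn ∘ φ) e) where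
  toIsPolarChart := isPolarChart_conformalMetric he hRo hR hf hf0 hO
  orthonormal := orthonormal_stdFrame _
  map_eq y hy := by
    rw [coordMap, Function.comp_apply, hO.map_eq _ hy.2, coe_stdEmbedding_polar]
  deriv_profile y hy := hρ _ (hO.colat_mem _ hy.2)

lemma contMDiffAt_rotational (n : ℕ) (hn : 3 ≤ n) (hRo : IsOpen R) (hR : R ⊆ Ioo 0 Real.pi)
    (hρ : ContDiffOn ℝ ∞ ρ R) (hO : IsRotationalOn ρ κ φ R θ₀ O) {p : Sph 2} (hp : p ∈ O) :
    ContMDiffAt (𝓡 2) (𝓡 n) ∞ (stdEmbedding n hn ∘ φ) p := by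
  refine contMDiffAt_of_coe hO.isOpen (fun q hq => ContMDiffAt.contMDiffWithinAt ?_) hp
  have hc := hO.colat_mem q hq
  have h1 : ContDiffAt ℝ ∞ (fun x : Euc 3 => ρ (Real.arccos (x 2))) (q : Euc 3) :=
    (hρ.contDiffAt (hRo.mem_nhds hc)).comp (q : Euc 3) (contDiffAt_colat (hR hc))
  have h2 : ContDiffAt ℝ ∞ (fun x : Euc 3 => κ * angleNear θ₀ x) (q : Euc 3) :=
    contDiffAt_const.mul (contDiffAt_angleNear (hO.meridianPart_pos q hq))
  have h3 : ContDiffAt ℝ ∞ (fun x : Euc 3 => polarPoint (stdFrame (Nat.le_succ_of_le hn))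
      (ρ (Real.arccos (x 2))) (κ * angleNear θ₀ x)) (q : Euc 3) := by
    unfold polarPoint
    exact ((((h1.sin).mul h2.cos).smul contDiffAt_const).add
      (((h1.sin).mul h2.sin).smul contDiffAt_const)).add (h1.cos.smul contDiffAt_const)
  refine (h3.contMDiffAt.comp q (contMDiff_coe 2 q)).congr_of_eventuallyEq ?_
  filter_upwards [hO.isOpen.mem_nhds hq] with z hz
  rw [Function.comp_apply, hO.map_eq z hz, coe_stdEmbedding_polar]
  rfl

/-- The data `(f, ρ, κ)` on an open set `R` of radii which make `(r, θ) ↦ (ρ(r), κ θ)` proper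
biharmonic and not weakly conformal with respect to `f⁻¹ (dr² + sin² r dθ²)`; here `ρ₁ = ρ'` and
`ρ₂ = ρ''`. With respect to `g₀` the tension field is `T ∂ρ`, with `T` the function in `tension_ne`.
The function `f T` is only required to agree near each point with a twice differentiable solution
`u` of the biharmonic equation, which leaves room for the absolute value in `f`. -/
structure IsBiharmonicProfile (f ρ ρ₁ ρ₂ : ℝ → ℝ) (κ : ℝ) (R : Set ℝ) : Prop where
  isOpen : IsOpen R
  subset : R ⊆ Ioo 0 Real.pi
  contDiffOn_factor : ContDiffOn ℝ ∞ f R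
  factor_pos : ∀ r ∈ R, 0 < f r
  contDiffOn_profile : ContDiffOn ℝ ∞ ρ R
  hasDerivAt : ∀ r ∈ R, HasDerivAt ρ (ρ₁ r) r
  hasDerivAt_deriv : ∀ r ∈ R, HasDerivAt ρ₁ (ρ₂ r) r
  tension_ne : ∀ r ∈ R, ρ₂ r + Real.cos r / Real.sin r * ρ₁ r -
    κ ^ 2 * (Real.sin (ρ r) * Real.cos (ρ r)) / Real.sin r ^ 2 ≠ 0
  ode : ∀ r₀ ∈ R, ∃ u u₁ u₂ : ℝ → ℝ, ∀ᶠ r in 𝓝 r₀,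
    f r * (ρ₂ r + Real.cos r / Real.sin r * ρ₁ r -
      κ ^ 2 * (Real.sin (ρ r) * Real.cos (ρ r)) / Real.sin r ^ 2) = u r ∧
    HasDerivAt u (u₁ r) r ∧ HasDerivAt u₁ (u₂ r) r ∧
    u₂ r + Real.cos r / Real.sin r * u₁ r -
      κ ^ 2 * Real.cos (2 * ρ r) / Real.sin r ^ 2 * u r = 0
  not_conformal : ∀ r ∈ R, ρ₁ r ^ 2 * Real.sin r ^ 2 ≠ κ ^ 2 * Real.sin (ρ r) ^ 2

/-- The reduction of the geometric statement to the conditions on `f`, `ρ` and `κ`. The biharmonic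
equation is checked in every chart; the other two properties are refuted at a single point. -/
theorem IsBiharmonicProfile.isProperBiharmonicOn (h : IsBiharmonicProfile f ρ ρ₁ ρ₂ κ R)
    (n : ℕ) (hn : 3 ≤ n)
    {U : Set (Sph 2)} (hU : U.Nonempty)
    (hφ : ∀ p ∈ U, ∃ θ₀ O, p ∈ O ∧ IsRotationalOn ρ κ φ R θ₀ O) :
    IsProperBiharmonicOn (conformalMetric f) (stdEmbedding n hn ∘ φ) U ∧
      ¬ IsWeaklyConformalOn (conformalMetric f) (stdEmbedding n hn ∘ φ) U := by
  obtain ⟨hRo, hR, hf, hf0, hρ, hρ₁, hρ₂, hT, hode, hconf⟩ := h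
  have hsmooth : ContMDiffOn (𝓡 2) (𝓡 n) ∞ (stdEmbedding n hn ∘ φ) U := fun p hp => by
    obtain ⟨θ₀, O, hpO, hO⟩ := hφ p hp
    exact (contMDiffAt_rotational n hn hRo hR hρ hO hpO).contMDiffWithinAt
  obtain ⟨p, hp⟩ := hU
  -- the chart at `p`, in which both harmonicity and weak conformality are refuted
  have he : chartAt (Euc 2) p ∈ IsManifold.maximalAtlas (𝓡 2) ∞ (Sph 2) :=
    IsManifold.chart_mem_maximalAtlas p
  have hpt : chartAt (Euc 2) p p ∈ (chartAt (Euc 2) p).target := mem_chart_target (Euc 2) p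
  have hpe : (chartAt (Euc 2) p).symm (chartAt (Euc 2) p p) = p :=
    (chartAt (Euc 2) p).left_inv (mem_chart_source (Euc 2) p)
  generalize chartAt (Euc 2) p = e at he hpt hpe
  obtain ⟨θ₀, O, hpO, hO⟩ := hφ p hp
  have hM := isRotationalMap_coordMap n hn he hRo hR hf hf0 hρ₁ hO
  have hx : e p ∈ e.target ∩ e.symm ⁻¹' O := ⟨hpt, by rwa [mem_preimage, hpe]⟩
  refine ⟨⟨⟨hsmooth, ?_⟩, ?_⟩, ?_⟩
  · intro e he x hx hxU
    obtain ⟨θ₀, O, hpO, hO⟩ := hφ _ hxU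
    obtain ⟨u, u₁, u₂, hu⟩ := hode _ (hO.colat_mem _ hpO)
    obtain ⟨I, hI, hIo, hxI⟩ := eventually_nhds_iff.1 hu
    -- shrink the neighbourhood so that the reduced equation holds on it
    have hO' : IsRotationalOn ρ κ φ R θ₀ (O ∩ colat ⁻¹' I) :=
      ⟨hO.isOpen.inter (hIo.preimage continuous_colat), fun q hq => hO.colat_mem q hq.1,
        fun q hq => hO.meridianPart_pos q hq.1, fun q hq => hO.map_eq q hq.1⟩
    have hM := isRotationalMap_coordMap n hn he hRo hR hf hf0 hρ₁ hO'
    rw [hM.bitension_eq (u := u) (u₁ := u₁) (u₂ := u₂) ?_ (fun y hy => (hI _ hy.2.2).2.1)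
      (fun y hy => (hI _ hy.2.2).2.2.1) ⟨hx, hpO, hxI⟩, (hI _ hxI).2.2.2, mul_zero, zero_smul]
    intro y hy
    rw [hM.tension_eq (ρ₂ := ρ₂) (fun y hy => hρ₂ _ (hO'.colat_mem _ hy.2)) hy, inv_inv,
      (hI _ hy.2.2).1]
  · intro h
    have h0 := h.tension_eq_zero e he (e p) hpt (by rwa [hpe])
    rw [hM.tension_eq (ρ₂ := ρ₂) (fun y hy => hρ₂ _ (hO.colat_mem _ hy.2)) hx, inv_inv, hpe] at h0
    have h1 : polarRadial (stdFrame (Nat.le_succ_of_le hn)) (ρ (colat p))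
        (κ * angleNear θ₀ p) ≠ 0 := by
      intro h1
      have h2 := inner_polarRadial_self (orthonormal_stdFrame (Nat.le_succ_of_le hn))
        (ρ (colat p)) (κ * angleNear θ₀ p)
      rw [h1, inner_zero_left] at h2
      exact zero_ne_one h2
    have hc := hO.colat_mem p hpO
    exact (smul_ne_zero (mul_ne_zero (hf0 _ hc).ne' (hT _ hc)) h1) h0
  · rintro ⟨Λ, hΛ⟩
    have hd : MDifferentiableAt (𝓡 2) 𝓘(ℝ, Euc (n + 1))
        (fun q => ((stdEmbedding n hn ∘ φ) q : Euc (n + 1))) (e.symm (e p)) := by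
      rw [hpe]
      exact (mdifferentiableAt_coe _).comp p
        ((contMDiffAt_rotational n hn hRo hR hρ hO hpO).mdifferentiableAt (by simp))
    have hpU : e.symm (e p) ∈ U := by rwa [hpe]
    have := hM.stretch_eq_of_inner_pd_eq hx (c := Λ (e.symm (e p))) (fun i j => by
      have h1 := (hΛ _ hpU).2
        (mfderiv (𝓡 2) (𝓡 2) e.symm (e p) (EuclideanSpace.single i (1 : ℝ) : Euc 2))
        (mfderiv (𝓡 2) (𝓡 2) e.symm (e p) (EuclideanSpace.single j (1 : ℝ) : Euc 2))
      rw [mvfderiv_comp_chart_symm he hpt hd, mvfderiv_comp_chart_symm he hpt hd] at h1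
      exact h1)
    simp only [hpe] at this
    exact hconf _ (hO.colat_mem p hpO) this

end ChartRotational

/-! ### Passing to a smooth determination of the polar angle -/

section Angle

lemma cos_eq_and_sin_eq_of_polar_eq {r θ θ' : ℝ} (hr : r ∈ Ioo 0 Real.pi)
    (h : polar r θ = polar r θ') :
    Real.cos θ = Real.cos θ' ∧ Real.sin θ = Real.sin θ' := by
  have hs := (Real.sin_pos_of_mem_Ioo hr).ne'
  have h0 : (polar r θ : Euc 3) 0 = (polar r θ' : Euc 3) 0 := by rw [h]
  have h1 : (polar r θ : Euc 3) 1 = (polar r θ' : Euc 3) 1 := by rw [h]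
  rw [coe_polar_zero, coe_polar_zero] at h0
  rw [coe_polar_one, coe_polar_one] at h1
  exact ⟨mul_left_cancel₀ hs h0, mul_left_cancel₀ hs h1⟩

lemma polar_congr {r θ θ' : ℝ} (hc : Real.cos θ = Real.cos θ') (hs : Real.sin θ = Real.sin θ') :
    polar r θ = polar r θ' := by
  apply Subtype.ext
  rw [coe_polar, coe_polar, polarPoint, polarPoint, hc, hs]

/-- Near each point of `U` the polar angle may be replaced by a smooth determination. A continuous
`θ` agrees with `angleNear (θ p)` near `p`, since the two differ by a multiple of `2π` that is less
than `2π`; for `k = 0` the map only depends on `θ` modulo `2π`, so no continuity is needed. -/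
lemma exists_isRotationalOn_rotMap (k : Fin 4) {R : Set ℝ} (hR : R ⊆ Ioo 0 Real.pi)
    {U : Set (Sph 2)} {θ : Sph 2 → ℝ} (hU : IsOpen U) (hUR : ∀ p ∈ U, colat p ∈ R)
    (hθ : ∀ p ∈ U, polar (colat p) (θ p) = p) (hk : k = 0 ∨ ContinuousOn θ U) {p : Sph 2}
    (hp : p ∈ U) : ∃ θ₀ O, p ∈ O ∧
      IsRotationalOn (profile k) (angularFactor k) (rotMap k θ) R θ₀ O := by
  have hmp : 0 < meridianPart (θ p) p := by
    have h := meridianPart_polar (colat p) (θ p)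
    rw [hθ p hp] at h
    exact h ▸ Real.sin_pos_of_mem_Ioo (hR (hUR p hp))
  have hm : ∀ᶠ q : Sph 2 in 𝓝 p, 0 < meridianPart (θ p) q :=
    (((contDiff_meridianPart (θ p)).continuous.comp continuous_subtype_val).tendsto p).eventually
      (lt_mem_nhds hmp)
  have hmap : ∀ᶠ q : Sph 2 in 𝓝 p, rotMap k θ q =
      polar (profile k (colat q)) (angularFactor k * angleNear (θ p) q) := by
    have hcs : ∀ q ∈ U, 0 < meridianPart (θ p) q → Real.cos (θ q) = Real.cos (angleNear (θ p) q) ∧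
        Real.sin (θ q) = Real.sin (angleNear (θ p) q) := fun q hq hq' =>
      cos_eq_and_sin_eq_of_polar_eq (hR (hUR q hq)) (by
         rw [hθ q hq, polar_angleNear hq' (hR (hUR q hq))])
    rcases hk with rfl | hk
    · filter_upwards [hU.mem_nhds hp, hm] with q hq hq'
      obtain ⟨h1, h2⟩ := hcs q hq hq'
      apply polar_congr <;> simp only [angularFactor]
      · rw [Real.cos_two_mul, Real.cos_two_mul, h1]
      · rw [Real.sin_two_mul, Real.sin_two_mul, h1, h2]
    · have hc : ∀ᶠ q : Sph 2 in 𝓝 p, |θ q - θ p| < Real.pi := by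
        have := (hk.continuousAt (hU.mem_nhds hp)).tendsto.eventually
          (Metric.ball_mem_nhds (θ p) Real.pi_pos)
        simpa [Real.dist_eq] using this
      filter_upwards [hU.mem_nhds hp, hm, hc] with q hq hq' hqc
      obtain ⟨h1, h2⟩ := hcs q hq hq'
      have h3 := angleNear_mem (θ p) q
      rw [abs_lt] at h3 hqc
      have h4 : Real.cos (θ q - angleNear (θ p) q) = 1 := by
        rw [Real.cos_sub, h1, h2]
        linear_combination Real.sin_sq_add_cos_sq (angleNear (θ p) q)
      have h5 := (Real.cos_eq_one_iff_of_lt_of_lt (by linarith) (by linarith)).1 h4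
      rw [rotMap, sub_eq_zero.1 h5]
  obtain ⟨O, hO, hOo, hpO⟩ := eventually_nhds_iff.1 ((hU.eventually_mem hp).and (hm.and hmap))
  exact ⟨θ p, O, hpO, hOo, fun q hq => hUR q (hO q hq).1, fun q hq => (hO q hq).2.1,
    fun q hq => (hO q hq).2.2⟩

end Angle

/-! ### The half-angle substitution -/

section HalfAngle

lemma cos_half_pos {r : ℝ} (hr : r ∈ Ioo 0 Real.pi) : 0 < Real.cos (r / 2) :=
  Real.cos_pos_of_mem_Ioo ⟨by linarith [hr.1, Real.pi_pos], by linarith [hr.2]⟩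

lemma tan_half_pos {r : ℝ} (hr : r ∈ Ioo 0 Real.pi) : 0 < Real.tan (r / 2) :=
  Real.tan_pos_of_pos_of_lt_pi_div_two (by linarith [hr.1]) (by linarith [hr.2])

lemma sin_sq_half {r : ℝ} (hr : r ∈ Ioo 0 Real.pi) :
    Real.sin (r / 2) ^ 2 = Real.tan (r / 2) ^ 2 / (1 + Real.tan (r / 2) ^ 2) := by
  have h := (cos_half_pos hr).ne'
  rw [Real.tan_eq_sin_div_cos]
  field_simp
  rw [Real.cos_sq_add_sin_sq, mul_one]

lemma sin_eq_tan_half {r : ℝ} (hr : r ∈ Ioo 0 Real.pi) :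
    Real.sin r = 2 * Real.tan (r / 2) / (1 + Real.tan (r / 2) ^ 2) := by
  have h := (cos_half_pos hr).ne'
  have h2 := Real.sin_two_mul (r / 2)
  rw [mul_div_cancel₀ r two_ne_zero] at h2
  rw [Real.tan_eq_sin_div_cos, h2]
  field_simp
  rw [Real.cos_sq_add_sin_sq, mul_one]

lemma cos_eq_tan_half {r : ℝ} (hr : r ∈ Ioo 0 Real.pi) :
    Real.cos r = (1 - Real.tan (r / 2) ^ 2) / (1 + Real.tan (r / 2) ^ 2) := by
  have h := (cos_half_pos hr).ne'
  have h2 := Real.cos_two_mul' (r / 2)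
  rw [mul_div_cancel₀ r two_ne_zero] at h2
  rw [Real.tan_eq_sin_div_cos, h2]
  field_simp
  rw [Real.cos_sq_add_sin_sq, mul_one]

/-- Differentiation through `t = tan (r / 2)`, for which `t' / t = 1 / sin r`. The derivative of `W`
is given in Euler form: `w` is the value of `t W'(t)`. In these terms the operator
`d²/dr² + cot r d/dr` becomes `(t d/dt)² / sin² r`. -/
lemma hasDerivAt_comp_tan_half {W : ℝ → ℝ} {w r : ℝ} (hr : r ∈ Ioo 0 Real.pi)
    (hW : HasDerivAt W (w / Real.tan (r / 2)) (Real.tan (r / 2))) :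
    HasDerivAt (fun r => W (Real.tan (r / 2))) (w / Real.sin r) r := by
  have hc := (cos_half_pos hr).ne'
  have ht := (tan_half_pos hr).ne'
  have h1 : HasDerivAt (fun r : ℝ => r / 2) (1 / 2) r := (hasDerivAt_id r).div_const 2
  have h2 := HasDerivAt.comp (h₂ := W) r hW (HasDerivAt.comp r (Real.hasDerivAt_tan hc) h1)
  refine h2.congr_deriv ?_
  have h3 : 1 / Real.cos (r / 2) ^ 2 = 1 + Real.tan (r / 2) ^ 2 := by
    rw [Real.tan_eq_sin_div_cos]
    field_simp
    exact (Real.cos_sq_add_sin_sq _).symm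
  rw [sin_eq_tan_half hr, h3]
  field_simp

lemma hasDerivAt_div_sin {W : ℝ → ℝ} {w r : ℝ} (hr : r ∈ Ioo 0 Real.pi)
    (hW : HasDerivAt W (w / Real.tan (r / 2)) (Real.tan (r / 2))) :
    HasDerivAt (fun r => W (Real.tan (r / 2)) / Real.sin r)
      ((w - Real.cos r * W (Real.tan (r / 2))) / Real.sin r ^ 2) r := by
  have hs := (Real.sin_pos_of_mem_Ioo hr).ne'
  refine ((hasDerivAt_comp_tan_half hr hW).fun_div (Real.hasDerivAt_sin r) hs).congr_deriv ?_
  field_simp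

lemma tendsto_tan_half_zero : Tendsto (fun r : ℝ => Real.tan (r / 2)) (𝓝[>] 0) (𝓝[>] 0) := by
  refine tendsto_nhdsWithin_iff.2 ⟨?_, ?_⟩
  · have : ContinuousAt (fun r : ℝ => Real.tan (r / 2)) 0 :=
      ContinuousAt.comp (g := Real.tan) (Real.continuousAt_tan.2 (by simp)) (by fun_prop)
    simpa using this.tendsto.mono_left nhdsWithin_le_nhds
  · filter_upwards [Ioo_mem_nhdsGT Real.pi_pos] with r hr using tan_half_pos hr

lemma tendsto_tan_half_pi :
    Tendsto (fun r : ℝ => Real.tan (r / 2)) (𝓝[<] Real.pi) atTop := by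
  refine Real.tendsto_tan_pi_div_two.comp (tendsto_nhdsWithin_iff.2 ⟨?_, ?_⟩)
  · exact (Continuous.tendsto (by fun_prop : Continuous fun r : ℝ => r / 2) Real.pi).mono_left
      nhdsWithin_le_nhds
  · filter_upwards [self_mem_nhdsWithin] with r hr
    simp only [mem_Iio] at hr ⊢
    linarith

end HalfAngle

/-! ### The regular radii -/

section Regular

/-- The sign `σ` of `g` is constant near a point where `g` does not vanish. -/
lemma exists_abs_eq_mul {g : ℝ → ℝ} {r₀ : ℝ} (hg : ContinuousAt g r₀) (h0 : g r₀ ≠ 0) :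
    ∃ σ : ℝ, ∀ᶠ r in 𝓝 r₀, |g r| = σ * g r := by
  rcases h0.lt_or_gt with h | h
  · refine ⟨-1, ?_⟩
    filter_upwards [hg.eventually (gt_mem_nhds h)] with r hr
    rw [abs_of_neg hr, neg_one_mul]
  · refine ⟨1, ?_⟩
    filter_upwards [hg.eventually (lt_mem_nhds h)] with r hr
    rw [abs_of_pos hr, one_mul]

lemma isOpen_regularRadii (k : Fin 4) : IsOpen (regularRadii k) := by
  refine isOpen_Ioo.sdiff (Set.Finite.isClosed ?_)
  fin_cases k <;> simp [singularRadii]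

lemma regularRadii_subset (k : Fin 4) : regularRadii k ⊆ Ioo 0 Real.pi := sdiff_subset

lemma contDiffAt_tan_half {r : ℝ} (hr : r ∈ Ioo 0 Real.pi) :
    ContDiffAt ℝ ∞ (fun r : ℝ => Real.tan (r / 2)) r :=
  ContDiffAt.comp (g := Real.tan) r (Real.contDiffAt_tan.2 (cos_half_pos hr).ne') (by fun_prop)

end Regular

/-! ### The first map -/

section First

variable {r : ℝ}

lemma profile_zero_eq (hr : r ∈ Ioo 0 Real.pi) :
    profile 0 r = 1 / 2 * Real.arccos (Real.tan (r / 2) ^ 2 / (1 + Real.tan (r / 2) ^ 2)) := by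
  rw [← sin_sq_half hr]
  rfl

lemma sqrt_one_sub_ratio_sq (t : ℝ) :
    √(1 - (t ^ 2 / (1 + t ^ 2)) ^ 2) = √(1 + 2 * t ^ 2) / (1 + t ^ 2) := by
  rw [Real.sqrt_eq_iff_mul_self_eq_of_pos (by positivity)]
  have := Real.sq_sqrt (show 0 ≤ 1 + 2 * t ^ 2 by positivity)
  field_simp
  rw [this]
  ring

/-- The defining property of the first profile: `cos 2ρ = sin² (r / 2)`. -/
lemma cos_two_profile_zero (hr : r ∈ Ioo 0 Real.pi) :
    Real.cos (2 * profile 0 r) = Real.tan (r / 2) ^ 2 / (1 + Real.tan (r / 2) ^ 2) := by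
  rw [profile_zero_eq hr, show ∀ x : ℝ, 2 * (1 / 2 * x) = x by intro x; ring, Real.cos_arccos]
  · linarith [show 0 ≤ Real.tan (r / 2) ^ 2 / (1 + Real.tan (r / 2) ^ 2) by positivity]
  · rw [div_le_one (by positivity)]
    linarith

lemma sin_mul_cos_profile_zero (hr : r ∈ Ioo 0 Real.pi) :
    Real.sin (profile 0 r) * Real.cos (profile 0 r) =
      √(1 + 2 * Real.tan (r / 2) ^ 2) / (2 * (1 + Real.tan (r / 2) ^ 2)) := by
  have h := Real.sin_two_mul (profile 0 r)
  have h1 : Real.sin (2 * profile 0 r) =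
      √(1 + 2 * Real.tan (r / 2) ^ 2) / (1 + Real.tan (r / 2) ^ 2) := by
    rw [profile_zero_eq hr, show ∀ x : ℝ, 2 * (1 / 2 * x) = x by intro x; ring, Real.sin_arccos,
      sqrt_one_sub_ratio_sq]
  rw [h1] at h
  rw [mul_comm 2 (1 + _), ← div_div, h]
  ring

lemma hasDerivAt_arccos_ratio {t : ℝ} (ht : 0 < t) :
    HasDerivAt (fun t : ℝ => 1 / 2 * Real.arccos (t ^ 2 / (1 + t ^ 2)))
      (-t ^ 2 / ((1 + t ^ 2) * √(1 + 2 * t ^ 2)) / t) t := by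
  have h1 : HasDerivAt (fun t : ℝ => t ^ 2) (2 * t) t := by simpa using hasDerivAt_pow 2 t
  have h2 := h1.fun_div (h1.const_add 1) (by positivity)
  have hlt : t ^ 2 / (1 + t ^ 2) < 1 := by
    rw [div_lt_one (by positivity)]
    linarith
  have hgt : -1 < t ^ 2 / (1 + t ^ 2) := lt_of_lt_of_le neg_one_lt_zero (by positivity)
  have h3 := HasDerivAt.comp t (Real.hasDerivAt_arccos hgt.ne' hlt.ne) h2
  refine (h3.const_mul (1 / 2)).congr_deriv ?_
  rw [sqrt_one_sub_ratio_sq]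
  have hq : 0 < √(1 + 2 * t ^ 2) := Real.sqrt_pos.2 (by positivity)
  field_simp
  ring

lemma hasDerivAt_arccos_ratio_euler {t : ℝ} (ht : 0 < t) :
    HasDerivAt (fun t : ℝ => -t ^ 2 / ((1 + t ^ 2) * √(1 + 2 * t ^ 2)))
      (-2 * t ^ 2 * (1 + t ^ 2 - t ^ 4) / ((1 + t ^ 2) ^ 2 * √(1 + 2 * t ^ 2) ^ 3) / t) t := by
  have h1 : HasDerivAt (fun t : ℝ => t ^ 2) (2 * t) t := by simpa using hasDerivAt_pow 2 t
  have hp : (0 : ℝ) < 1 + 2 * t ^ 2 := by positivity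
  have hq : 0 < √(1 + 2 * t ^ 2) := Real.sqrt_pos.2 hp
  have h2 := ((h1.const_mul 2).const_add 1).sqrt hp.ne'
  refine (h1.fun_neg.fun_div ((h1.const_add 1).fun_mul h2) (by positivity)).congr_deriv ?_
  have hs := Real.sq_sqrt hp.le
  generalize √(1 + 2 * t ^ 2) = q at *
  field_simp
  rw [hs]
  ring

/-- The first conformal factor with the denominator `τ⁻²` cleared, as a function continuous at
`τ = 0`. -/
lemma factor_zero_eq (hr : r ∈ Ioo 0 Real.pi) : factor 0 r =
    4 * (1 + Real.tan (r / 2) ^ 2) * √(1 + 2 * Real.tan (r / 2) ^ 2) ^ 3 *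
      Real.tan (r / 2) ^ 2 / (3 * Real.tan (r / 2) ^ 6 + 9 * Real.tan (r / 2) ^ 4 +
        6 * Real.tan (r / 2) ^ 2 + 1) := by
  have ht := tan_half_pos hr
  have h1 : Real.cot (r / 2) = (Real.tan (r / 2))⁻¹ := by
    rw [Real.tan_eq_sin_div_cos, Real.cot_eq_cos_div_sin, inv_div]
  have h2 : (1 + 2 * Real.tan (r / 2) ^ 2) ^ (3 / 2 : ℝ) = √(1 + 2 * Real.tan (r / 2) ^ 2) ^ 3 := by
    rw [Real.sqrt_eq_rpow, ← Real.rpow_mul_natCast (by positivity)]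
    norm_num
  simp only [factor]
  rw [h1, h2]
  field_simp

lemma regularRadii_zero : regularRadii 0 = Ioo 0 Real.pi := by
  simp [regularRadii, singularRadii]

/-- The profile `ρ = ½ arccos (sin² (r / 2))` with `κ = 2`: here `f T = -2 (1 + τ²)`. -/
lemma isBiharmonicProfile_zero : IsBiharmonicProfile (factor 0) (profile 0)
    (fun r => -Real.tan (r / 2) ^ 2 / ((1 + Real.tan (r / 2) ^ 2) *
      √(1 + 2 * Real.tan (r / 2) ^ 2)) / Real.sin r)
    (fun r => (-2 * Real.tan (r / 2) ^ 2 * (1 + Real.tan (r / 2) ^ 2 - Real.tan (r / 2) ^ 4) /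
      ((1 + Real.tan (r / 2) ^ 2) ^ 2 * √(1 + 2 * Real.tan (r / 2) ^ 2) ^ 3) -
      Real.cos r * (-Real.tan (r / 2) ^ 2 / ((1 + Real.tan (r / 2) ^ 2) *
        √(1 + 2 * Real.tan (r / 2) ^ 2)))) / Real.sin r ^ 2)
    (angularFactor 0) (regularRadii 0) := by
  have hpr : ∀ r ∈ regularRadii 0, profile 0 =ᶠ[𝓝 r] fun r =>
      1 / 2 * Real.arccos (Real.tan (r / 2) ^ 2 / (1 + Real.tan (r / 2) ^ 2)) := fun r hr => by
    filter_upwards [(isOpen_regularRadii 0).mem_nhds hr] with q hq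
      using profile_zero_eq (regularRadii_subset 0 hq)
  -- the tension of `φ₁` with respect to `g₀`
  have hT : ∀ r ∈ Ioo 0 Real.pi,
      (-2 * Real.tan (r / 2) ^ 2 * (1 + Real.tan (r / 2) ^ 2 - Real.tan (r / 2) ^ 4) /
      ((1 + Real.tan (r / 2) ^ 2) ^ 2 * √(1 + 2 * Real.tan (r / 2) ^ 2) ^ 3) -
      Real.cos r * (-Real.tan (r / 2) ^ 2 / ((1 + Real.tan (r / 2) ^ 2) *
        √(1 + 2 * Real.tan (r / 2) ^ 2)))) / Real.sin r ^ 2 +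
      Real.cos r / Real.sin r * (-Real.tan (r / 2) ^ 2 / ((1 + Real.tan (r / 2) ^ 2) *
      √(1 + 2 * Real.tan (r / 2) ^ 2)) / Real.sin r) -
      angularFactor 0 ^ 2 * (Real.sin (profile 0 r) * Real.cos (profile 0 r)) / Real.sin r ^ 2 =
      -(3 * Real.tan (r / 2) ^ 6 + 9 * Real.tan (r / 2) ^ 4 + 6 * Real.tan (r / 2) ^ 2 + 1) /
        (2 * Real.tan (r / 2) ^ 2 * √(1 + 2 * Real.tan (r / 2) ^ 2) ^ 3) := by
    intro r hr
    have ht := tan_half_pos hr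
    have hs := Real.sin_pos_of_mem_Ioo hr
    rw [sin_mul_cos_profile_zero hr]
    have e : ∀ a b c d s : ℝ, s ≠ 0 → (a - c * b) / s ^ 2 + c / s * (b / s) -
        angularFactor 0 ^ 2 * d / s ^ 2 = (a - 4 * d) / s ^ 2 := by
      intro a b c d s hs
      simp only [angularFactor]
      field_simp
      ring
    rw [e _ _ _ _ _ hs.ne', sin_eq_tan_half hr]
    have hp : (0 : ℝ) < 1 + 2 * Real.tan (r / 2) ^ 2 := by positivity
    have hq : 0 < √(1 + 2 * Real.tan (r / 2) ^ 2) := Real.sqrt_pos.2 hp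
    have hsq := Real.sq_sqrt hp.le
    generalize √(1 + 2 * Real.tan (r / 2) ^ 2) = q at *
    field_simp
    rw [show q ^ 4 = (q ^ 2) ^ 2 by ring, hsq]
    ring
  refine ⟨isOpen_regularRadii 0, regularRadii_subset 0, ?_, ?_, ?_, ?_, ?_, ?_, ?_, ?_⟩
  · intro r hr
    have hr' := regularRadii_subset 0 hr
    have ht := tan_half_pos hr'
    have h1 := contDiffAt_tan_half hr'
    have h2 : ContDiffAt ℝ ∞ (fun r : ℝ => √(1 + 2 * Real.tan (r / 2) ^ 2)) r :=
      (contDiffAt_const.add (contDiffAt_const.mul (h1.pow 2))).sqrt (by positivity)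
    have h3 : ContDiffAt ℝ ∞ (fun r =>
        4 * (1 + Real.tan (r / 2) ^ 2) * √(1 + 2 * Real.tan (r / 2) ^ 2) ^ 3 *
          Real.tan (r / 2) ^ 2 / (3 * Real.tan (r / 2) ^ 6 + 9 * Real.tan (r / 2) ^ 4 +
        6 * Real.tan (r / 2) ^ 2 + 1)) r :=
      ContDiffAt.div (by fun_prop) (by fun_prop) (by positivity)
    refine (h3.congr_of_eventuallyEq ?_).contDiffWithinAt
    filter_upwards [(isOpen_regularRadii 0).mem_nhds hr] with q hq
      using factor_zero_eq (regularRadii_subset 0 hq)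
  · intro r hr
    have hr' := regularRadii_subset 0 hr
    have ht := tan_half_pos hr'
    rw [factor_zero_eq hr']
    positivity
  · intro r hr
    have hr' := regularRadii_subset 0 hr
    have ht := tan_half_pos hr'
    have h1 := contDiffAt_tan_half hr'
    have h2 : ContDiffAt ℝ ∞ (fun r : ℝ => Real.tan (r / 2) ^ 2 / (1 + Real.tan (r / 2) ^ 2)) r :=
      ContDiffAt.div (by fun_prop) (by fun_prop) (by positivity)
    have hlt : Real.tan (r / 2) ^ 2 / (1 + Real.tan (r / 2) ^ 2) < 1 := by
      rw [div_lt_one (by positivity)]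
      linarith
    have hgt : -1 < Real.tan (r / 2) ^ 2 / (1 + Real.tan (r / 2) ^ 2) :=
      lt_of_lt_of_le neg_one_lt_zero (by positivity)
    have h3 : ContDiffAt ℝ ∞ (fun r : ℝ =>
        1 / 2 * Real.arccos (Real.tan (r / 2) ^ 2 / (1 + Real.tan (r / 2) ^ 2))) r :=
      contDiffAt_const.mul (ContDiffAt.comp (g := Real.arccos) r
        (Real.contDiffAt_arccos hgt.ne' hlt.ne) h2)
    exact (h3.congr_of_eventuallyEq (hpr r hr)).contDiffWithinAt
  · intro r hr
    have hr' := regularRadii_subset 0 hr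
    exact (hasDerivAt_comp_tan_half hr' (hasDerivAt_arccos_ratio
      (tan_half_pos hr'))).congr_of_eventuallyEq (hpr r hr)
  · intro r hr
    have hr' := regularRadii_subset 0 hr
    exact hasDerivAt_div_sin hr' (hasDerivAt_arccos_ratio_euler (tan_half_pos hr'))
  · intro r hr
    have hr' := regularRadii_subset 0 hr
    have ht := tan_half_pos hr'
    rw [hT r hr']
    exact div_ne_zero (neg_ne_zero.2 (by positivity)) (by positivity)
  · intro r₀ hr₀
    refine ⟨fun r => -2 * (1 + Real.tan (r / 2) ^ 2),
      fun r => -4 * Real.tan (r / 2) ^ 2 / Real.sin r,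
      fun r => (-8 * Real.tan (r / 2) ^ 2 - Real.cos r * (-4 * Real.tan (r / 2) ^ 2)) /
        Real.sin r ^ 2, ?_⟩
    filter_upwards [(isOpen_regularRadii 0).mem_nhds hr₀] with r hr
    have hr' := regularRadii_subset 0 hr
    have ht := tan_half_pos hr'
    have hs := Real.sin_pos_of_mem_Ioo hr'
    have hsq : HasDerivAt (fun t : ℝ => t ^ 2) (2 * Real.tan (r / 2)) (Real.tan (r / 2)) := by
      simpa using hasDerivAt_pow 2 (Real.tan (r / 2))
    refine ⟨?_, ?_, ?_, ?_⟩
    · rw [hT r hr', factor_zero_eq hr']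
      have hq : 0 < √(1 + 2 * Real.tan (r / 2) ^ 2) := Real.sqrt_pos.2 (by positivity)
      field_simp
      ring
    · refine hasDerivAt_comp_tan_half (W := fun t => -2 * (1 + t ^ 2)) hr'
        (((hsq.const_add 1).const_mul (-2)).congr_deriv ?_)
      field_simp
      ring
    · refine hasDerivAt_div_sin (W := fun t => -4 * t ^ 2) hr'
        ((hsq.const_mul (-4)).congr_deriv ?_)
      field_simp
      ring
    · rw [cos_two_profile_zero hr']
      simp only [angularFactor]
      field_simp
      ring
  · intro r hr h
    have hr' := regularRadii_subset 0 hr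
    have ht := tan_half_pos hr'
    have hs := Real.sin_pos_of_mem_Ioo hr'
    have h2 := Real.cos_sq' (profile 0 r)
    have h3 := Real.cos_two_mul (profile 0 r)
    rw [cos_two_profile_zero hr', h2] at h3
    have h4 : Real.sin (profile 0 r) ^ 2 = 1 / (2 * (1 + Real.tan (r / 2) ^ 2)) := by
      have : Real.sin (profile 0 r) ^ 2 =
        (1 - Real.tan (r / 2) ^ 2 / (1 + Real.tan (r / 2) ^ 2)) / 2 := by linarith
      rw [this]
      field_simp
      ring
    rw [h4] at h
    simp only [angularFactor] at h
    have hsq := Real.sq_sqrt (show 0 ≤ 1 + 2 * Real.tan (r / 2) ^ 2 by positivity)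
    have hq : 0 < √(1 + 2 * Real.tan (r / 2) ^ 2) := Real.sqrt_pos.2 (by positivity)
    generalize √(1 + 2 * Real.tan (r / 2) ^ 2) = q at *
    field_simp at h
    rw [hsq] at h
    nlinarith [pow_pos ht 2, pow_pos ht 4]

end First

/-! ### The second and third maps -/

section Second

/-- The function of `τ = tan (r / 2)` whose absolute value is the second conformal factor for
`s = √3` and the third for `s = -√3`. -/
noncomputable def powerFactor (s t : ℝ) : ℝ :=
  t ^ (1 + s) * (t ^ 2 + 7 + 4 * s) * (t ^ 2 - 2 - s) / ((1 + t ^ 2) ^ 2 * (t ^ 2 - 1))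

lemma factor_two (r : ℝ) : factor 2 r = |powerFactor (-√3) (Real.tan (r / 2))| := by
  simp only [factor, powerFactor, mul_neg, sub_neg_eq_add, ← sub_eq_add_neg]

/-- The Euler derivative `t d/dt` on functions `tˢ A(t) / (1 + t²)ᵐ`; `a` is the Euler derivative of
`A`. -/
lemma hasDerivAt_rpow_mul_div {A : ℝ → ℝ} {a s t : ℝ} (m : ℕ) (ht : 0 < t)
    (hA : HasDerivAt A (a / t) t) :
    HasDerivAt (fun t => t ^ s * A t / (1 + t ^ 2) ^ m)
      (t ^ s * ((s * A t + a) * (1 + t ^ 2) - 2 * m * t ^ 2 * A t) / (1 + t ^ 2) ^ (m + 1) / t)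
      t := by
  have h1 : HasDerivAt (fun t : ℝ => t ^ 2) (2 * t) t := by simpa using hasDerivAt_pow 2 t
  have h2 : HasDerivAt (fun t : ℝ => t ^ s) (s * t ^ s / t) t := by
    refine (Real.hasDerivAt_rpow_const (Or.inl ht.ne')).congr_deriv ?_
    rw [Real.rpow_sub_one ht.ne']
    ring
  have h3 : HasDerivAt (fun t : ℝ => (1 + t ^ 2) ^ m) (m * (1 + t ^ 2) ^ m * (2 * t) /
      (1 + t ^ 2)) t := by
    refine ((h1.const_add 1).fun_pow m).congr_deriv ?_
    rcases m with _ | m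
    · simp
    · simp
      field_simp
      ring
  refine ((h2.fun_mul hA).fun_div h3 (by positivity)).congr_deriv ?_
  field_simp
  ring

/-- The polynomial identity behind the equation `(t d/dt)² W = 3 cos 2r W` for
`W = tˢ A / (1 + t²)²`, where `A = (t² + 7 + 4 s) (t² - 2 - s)` and `t = tan (r / 2)`: the left
side is the numerator of `(t d/dt)² W`, with `tˢ / (1 + t²)⁴` removed. -/
lemma powerFactor_ode {s t : ℝ} (hs : s ^ 2 = 3) :
    (s * ((s * ((t ^ 2 + 7 + 4 * s) * (t ^ 2 - 2 - s)) +
        (4 * t ^ 4 + (10 + 6 * s) * t ^ 2)) * (1 + t ^ 2) -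
        4 * t ^ 2 * ((t ^ 2 + 7 + 4 * s) * (t ^ 2 - 2 - s))) +
      ((s * (4 * t ^ 4 + (10 + 6 * s) * t ^ 2) + (16 * t ^ 4 + (20 + 12 * s) * t ^ 2)) *
          (1 + t ^ 2) +
        (s * ((t ^ 2 + 7 + 4 * s) * (t ^ 2 - 2 - s)) + (4 * t ^ 4 + (10 + 6 * s) * t ^ 2)) *
          (2 * t ^ 2) - 8 * t ^ 2 * ((t ^ 2 + 7 + 4 * s) * (t ^ 2 - 2 - s)) -
        4 * t ^ 2 * (4 * t ^ 4 + (10 + 6 * s) * t ^ 2))) * (1 + t ^ 2) -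
      6 * t ^ 2 * ((s * ((t ^ 2 + 7 + 4 * s) * (t ^ 2 - 2 - s)) +
        (4 * t ^ 4 + (10 + 6 * s) * t ^ 2)) * (1 + t ^ 2) -
        4 * t ^ 2 * ((t ^ 2 + 7 + 4 * s) * (t ^ 2 - 2 - s))) =
    3 * (1 - 6 * t ^ 2 + t ^ 4) * ((t ^ 2 + 7 + 4 * s) * (t ^ 2 - 2 - s)) := by
  grind

lemma eq_two_arctan_tan_half {r : ℝ} (hr : r ∈ Ioo 0 Real.pi) :
    r = 2 * Real.arctan (Real.tan (r / 2)) := by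
  rw [Real.arctan_tan (by linarith [hr.1, Real.pi_pos]) (by linarith [hr.2])]
  ring

lemma tan_half_sq_ne {r c : ℝ} (hr : r ∈ Ioo 0 Real.pi) (h : r ≠ 2 * Real.arctan √c) :
    Real.tan (r / 2) ^ 2 ≠ c := by
  rintro rfl
  rw [Real.sqrt_sq (tan_half_pos hr).le] at h
  exact h (eq_two_arctan_tan_half hr)

lemma two_arctan_one : 2 * Real.arctan √1 = Real.pi / 2 := by
  rw [Real.sqrt_one, Real.arctan_one]
  ring

lemma seven_add_pos {s : ℝ} (hs : s ^ 2 = 3) : 0 < 7 + 4 * s := by nlinarith [sq_nonneg (4 * s + 7)]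

lemma two_add_pos {s : ℝ} (hs : s ^ 2 = 3) : 0 < 2 + s := by nlinarith [sq_nonneg (s + 2)]

lemma contDiffAt_powerFactor {s t : ℝ} (ht : 0 < t) (h1 : t ^ 2 ≠ 1) :
    ContDiffAt ℝ ∞ (powerFactor s) t := by
  have h := sub_ne_zero.2 h1
  have h2 : ContDiffAt ℝ ∞ (fun t : ℝ => t ^ (1 + s)) t := Real.contDiffAt_rpow_const_of_ne ht.ne'
  exact ContDiffAt.div (by fun_prop) (by fun_prop) (by positivity)

lemma powerFactor_ne_zero {s t : ℝ} (hs : s ^ 2 = 3) (ht : 0 < t) (h1 : t ^ 2 ≠ 1)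
    (h2 : t ^ 2 ≠ 2 + s) : powerFactor s t ≠ 0 := by
  have h3 := sub_ne_zero.2 h1
  have h4 : t ^ 2 - 2 - s ≠ 0 := fun h => h2 (by linarith)
  have h5 : t ^ 2 + 7 + 4 * s ≠ 0 := by nlinarith [seven_add_pos hs, sq_nonneg t]
  unfold powerFactor
  positivity

/-- The identity profile with `κ² = 3`: here `f T = ±τˢ (τ² + 7 + 4 s) (τ² - 2 - s) / (1 + τ²)²`. -/
lemma isBiharmonicProfile_power {s κ : ℝ} (hs : s ^ 2 = 3) (hκ : κ ^ 2 = 3) {R : Set ℝ}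
    (hRo : IsOpen R) (hR : R ⊆ Ioo 0 Real.pi)
    (hR1 : ∀ r ∈ R, Real.tan (r / 2) ^ 2 ≠ 1) (hR2 : ∀ r ∈ R, Real.tan (r / 2) ^ 2 ≠ 2 + s) :
    IsBiharmonicProfile (fun r => |powerFactor s (Real.tan (r / 2))|) (fun r => r) (fun _ => 1)
      (fun _ => 0) κ R := by
  have hne : ∀ r ∈ R, powerFactor s (Real.tan (r / 2)) ≠ 0 := fun r hr =>
    powerFactor_ne_zero hs (tan_half_pos (hR hr)) (hR1 r hr) (hR2 r hr)
  have hcd : ∀ r ∈ R, ContDiffAt ℝ ∞ (fun r => powerFactor s (Real.tan (r / 2))) r := fun r hr =>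
    ContDiffAt.comp (g := powerFactor s) r
      (contDiffAt_powerFactor (tan_half_pos (hR hr)) (hR1 r hr)) (contDiffAt_tan_half (hR hr))
  have hT : ∀ r ∈ R, 0 + Real.cos r / Real.sin r * 1 -
      κ ^ 2 * (Real.sin r * Real.cos r) / Real.sin r ^ 2 =
        (Real.tan (r / 2) ^ 2 - 1) / Real.tan (r / 2) := by
    intro r hr
    have ht := tan_half_pos (hR hr)
    rw [hκ, sin_eq_tan_half (hR hr), cos_eq_tan_half (hR hr)]
    field_simp
    ring
  refine ⟨hRo, hR, fun r hr => ((hcd r hr).abs (hne r hr)).contDiffWithinAt,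
    fun r hr => abs_pos.2 (hne r hr), contDiffOn_id, fun r _ => hasDerivAt_id r,
    fun r _ => hasDerivAt_const r 1, ?_, ?_, ?_⟩
  · intro r hr
    rw [hT r hr]
    exact div_ne_zero (sub_ne_zero.2 (hR1 r hr)) (tan_half_pos (hR hr)).ne'
  · intro r₀ hr₀
    obtain ⟨σ, habs⟩ := exists_abs_eq_mul (hcd r₀ hr₀).continuousAt (hne r₀ hr₀)
    -- `A`, `B`, `C` are the numerators of the solution and of its first two Euler derivatives
    let A : ℝ → ℝ := fun t => (t ^ 2 + 7 + 4 * s) * (t ^ 2 - 2 - s)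
    let a : ℝ → ℝ := fun t => 4 * t ^ 4 + (10 + 6 * s) * t ^ 2
    let a' : ℝ → ℝ := fun t => 16 * t ^ 4 + (20 + 12 * s) * t ^ 2
    let B : ℝ → ℝ := fun t => (s * A t + a t) * (1 + t ^ 2) - 4 * t ^ 2 * A t
    let b : ℝ → ℝ := fun t => (s * a t + a' t) * (1 + t ^ 2) + (s * A t + a t) * (2 * t ^ 2) -
      8 * t ^ 2 * A t - 4 * t ^ 2 * a t
    let C : ℝ → ℝ := fun t => (s * B t + b t) * (1 + t ^ 2) - 6 * t ^ 2 * B t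
    have hA : ∀ t > 0, HasDerivAt A (a t / t) t := by
      intro t ht
      have h1 : HasDerivAt (fun t : ℝ => t ^ 2) (2 * t) t := by simpa using hasDerivAt_pow 2 t
      refine ((((h1.add_const 7).add_const (4 * s)).fun_mul
        ((h1.sub_const 2).sub_const s))).congr_deriv ?_
      simp only [a]
      field_simp
      ring
    have ha : ∀ t > 0, HasDerivAt a (a' t / t) t := by
      intro t ht
      have h1 : HasDerivAt (fun t : ℝ => t ^ 2) (2 * t) t := by simpa using hasDerivAt_pow 2 t
      have h2 : HasDerivAt (fun t : ℝ => t ^ 4) (4 * t ^ 3) t := by simpa using hasDerivAt_pow 4 t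
      refine ((h2.const_mul 4).fun_add (h1.const_mul (10 + 6 * s))).congr_deriv ?_
      simp only [a']
      field_simp
      ring
    have hB : ∀ t > 0, HasDerivAt B (b t / t) t := by
      intro t ht
      have h1 : HasDerivAt (fun t : ℝ => t ^ 2) (2 * t) t := by simpa using hasDerivAt_pow 2 t
      refine (((((hA t ht).const_mul s).fun_add (ha t ht)).fun_mul (h1.const_add 1)).fun_sub
        ((h1.const_mul 4).fun_mul (hA t ht))).congr_deriv ?_
      simp only [b]
      field_simp
      ring
    let W : ℝ → ℝ := fun t => t ^ s * A t / (1 + t ^ 2) ^ 2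
    let W₁ : ℝ → ℝ := fun t => t ^ s * B t / (1 + t ^ 2) ^ 3
    let W₂ : ℝ → ℝ := fun t => t ^ s * C t / (1 + t ^ 2) ^ 4
    have hW : ∀ t > 0, HasDerivAt W (W₁ t / t) t := by
      intro t ht
      refine (hasDerivAt_rpow_mul_div 2 ht (hA t ht)).congr_deriv ?_
      simp only [W₁, B]
      norm_num
    have hW₁ : ∀ t > 0, HasDerivAt W₁ (W₂ t / t) t := by
      intro t ht
      refine (hasDerivAt_rpow_mul_div 3 ht (hB t ht)).congr_deriv ?_
      simp only [W₂, C]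
      norm_num
    refine ⟨fun r => σ * W (Real.tan (r / 2)), fun r => σ * (W₁ (Real.tan (r / 2)) / Real.sin r),
      fun r => σ * ((W₂ (Real.tan (r / 2)) - Real.cos r * W₁ (Real.tan (r / 2))) /
        Real.sin r ^ 2), ?_⟩
    filter_upwards [hRo.mem_nhds hr₀, habs] with r hr hra
    have ht := tan_half_pos (hR hr)
    have hsin := Real.sin_pos_of_mem_Ioo (hR hr)
    refine ⟨?_, (hasDerivAt_comp_tan_half (hR hr) (hW _ ht)).const_mul σ,
      (hasDerivAt_div_sin (hR hr) (hW₁ _ ht)).const_mul σ, ?_⟩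
    · rw [hra, hT r hr]
      have h1 := sub_ne_zero.2 (hR1 r hr)
      simp only [powerFactor, W, A]
      rw [Real.rpow_add ht, Real.rpow_one]
      field_simp
    · have hC : C (Real.tan (r / 2)) = 3 * (1 - 6 * Real.tan (r / 2) ^ 2 +
          Real.tan (r / 2) ^ 4) * A (Real.tan (r / 2)) := powerFactor_ode hs
      rw [hκ, Real.cos_two_mul]
      have e : ∀ w w₁ w₂ c S : ℝ, S ≠ 0 → σ * ((w₂ - c * w₁) / S ^ 2) +
          c / S * (σ * (w₁ / S)) - 3 * (2 * c ^ 2 - 1) / S ^ 2 * (σ * w) =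
          σ / S ^ 2 * (w₂ - 3 * (2 * c ^ 2 - 1) * w) := by
        intro w w₁ w₂ c S hS
        field_simp
        ring
      rw [e _ _ _ _ _ hsin.ne']
      simp only [W₂, W]
      rw [hC, cos_eq_tan_half (hR hr)]
      field_simp
      ring
  · intro r hr h
    have hsin := Real.sin_pos_of_mem_Ioo (hR hr)
    rw [hκ] at h
    nlinarith [pow_pos hsin 2]

end Second

/-! ### The fourth map -/

section Third

/-- The fourth conformal factor in a form continuous at the poles. At `r = 0` and `r = π` both sides
vanish, on the left because of `tan r = 0`. -/
lemma factor_three (r : ℝ) (hr : r ∈ Icc 0 Real.pi) :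
    factor 3 r = |√(Real.sin r) * Real.sin (√3 / 2 * r) / Real.cos r| := by
  have hs := Real.sin_nonneg_of_mem_Icc hr
  have h := Real.sq_sqrt hs
  have e : Real.tan r * Real.sin (√3 / 2 * r) / √(Real.sin r) =
      √(Real.sin r) * Real.sin (√3 / 2 * r) / Real.cos r := by
    rcases hs.eq_or_lt with h0 | h0
    · simp [← h0]
    · have hq : 0 < √(Real.sin r) := Real.sqrt_pos.2 h0
      rw [Real.tan_eq_sin_div_cos]
      nth_rewrite 1 [← h]
      field_simp
  simp only [factor]
  rw [e]

lemma sin_sqrt_three_pos {r : ℝ} (hr : r ∈ Ioo 0 Real.pi) : 0 < Real.sin (√3 / 2 * r) := by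
  have h3 : √3 < 2 := by
    rw [Real.sqrt_lt' two_pos]
    norm_num
  have h0 : 0 < √3 := by positivity
  apply Real.sin_pos_of_pos_of_lt_pi
  · have := hr.1
    positivity
  · nlinarith [hr.1, hr.2]

lemma cos_ne_zero_of_mem {r : ℝ} (hr : r ∈ regularRadii 3) : Real.cos r ≠ 0 := by
  obtain ⟨hr, h⟩ := hr
  intro hc
  refine h (Real.injOn_cos (Ioo_subset_Icc_self hr) ⟨by positivity, by linarith [Real.pi_pos]⟩ ?_)
  rw [hc, Real.cos_pi_div_two]

/-- The identity profile with `κ = ½`: here `f T = ±¾ sin (√3 r / 2) / √(sin r)`. -/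
lemma isBiharmonicProfile_three : IsBiharmonicProfile (factor 3) (profile 3) (fun _ => 1)
    (fun _ => 0) (angularFactor 3) (regularRadii 3) := by
  have hRo := isOpen_regularRadii 3
  have hR := regularRadii_subset 3
  have hpos : ∀ r ∈ regularRadii 3, 0 < Real.sin r := fun r hr => Real.sin_pos_of_mem_Ioo (hR hr)
  have hne : ∀ r ∈ regularRadii 3, √(Real.sin r) * Real.sin (√3 / 2 * r) / Real.cos r ≠ 0 :=
    fun r hr => div_ne_zero (mul_ne_zero (Real.sqrt_pos.2 (hpos r hr)).ne'
      (sin_sqrt_three_pos (hR hr)).ne') (cos_ne_zero_of_mem hr)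
  have hcd : ∀ r ∈ regularRadii 3, ContDiffAt ℝ ∞
      (fun r => √(Real.sin r) * Real.sin (√3 / 2 * r) / Real.cos r) r := fun r hr =>
    ContDiffAt.div ((Real.contDiff_sin.contDiffAt.sqrt (hpos r hr).ne').mul
      (Real.contDiff_sin.contDiffAt.comp r (by fun_prop))) Real.contDiff_cos.contDiffAt
      (cos_ne_zero_of_mem hr)
  have hfac : ∀ r ∈ regularRadii 3, factor 3 =ᶠ[𝓝 r]
      fun r => |√(Real.sin r) * Real.sin (√3 / 2 * r) / Real.cos r| := fun r hr => by
    filter_upwards [hRo.mem_nhds hr] with q hq using factor_three q (Ioo_subset_Icc_self (hR hq))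
  have hT : ∀ r ∈ regularRadii 3, 0 + Real.cos r / Real.sin r * 1 - angularFactor 3 ^ 2 *
      (Real.sin (profile 3 r) * Real.cos (profile 3 r)) / Real.sin r ^ 2 =
        3 / 4 * (Real.cos r / Real.sin r) := by
    intro r hr
    have := hpos r hr
    simp only [angularFactor, profile]
    field_simp
    ring
  refine ⟨hRo, hR, fun r hr => (((hcd r hr).abs (hne r hr)).congr_of_eventuallyEq
    (hfac r hr)).contDiffWithinAt, fun r hr => ?_, contDiffOn_id, fun r _ => hasDerivAt_id r,
    fun r _ => hasDerivAt_const r 1, ?_, ?_, ?_⟩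
  · rw [(hfac r hr).self_of_nhds]
    exact abs_pos.2 (hne r hr)
  · intro r hr
    rw [hT r hr]
    exact mul_ne_zero (by norm_num) (div_ne_zero (cos_ne_zero_of_mem hr) (hpos r hr).ne')
  · intro r₀ hr₀
    obtain ⟨σ, habs⟩ := exists_abs_eq_mul (hcd r₀ hr₀).continuousAt (hne r₀ hr₀)
    refine ⟨fun r => σ * (3 / 4) * (Real.sin (√3 / 2 * r) / √(Real.sin r)),
      fun r => σ * (3 / 4) * (√3 / 2 * Real.cos (√3 / 2 * r) / √(Real.sin r) -
        Real.sin (√3 / 2 * r) * Real.cos r / (2 * √(Real.sin r) ^ 3)),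
      fun r => σ * (3 / 4) * (-(3 / 4) * Real.sin (√3 / 2 * r) / √(Real.sin r) -
        √3 / 2 * Real.cos (√3 / 2 * r) * Real.cos r / √(Real.sin r) ^ 3 +
        Real.sin (√3 / 2 * r) / (2 * √(Real.sin r)) +
        3 * Real.sin (√3 / 2 * r) * Real.cos r ^ 2 / (4 * √(Real.sin r) ^ 5)), ?_⟩
    filter_upwards [hRo.mem_nhds hr₀, habs, hfac r₀ hr₀] with r hr hra hrf
    have hs := hpos r hr
    have hq : 0 < √(Real.sin r) := Real.sqrt_pos.2 hs
    have hsq := Real.sq_sqrt hs.le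
    have hl : HasDerivAt (fun r : ℝ => √3 / 2 * r) (√3 / 2) r := by
      simpa using (hasDerivAt_id r).const_mul (√3 / 2)
    have hA := hl.sin
    have hA' := hl.cos
    have hS := (Real.hasDerivAt_sin r).sqrt hs.ne'
    have hS3 : HasDerivAt (fun r => √(Real.sin r) ^ 3)
        (3 * √(Real.sin r) ^ 2 * (Real.cos r / (2 * √(Real.sin r)))) r := by
      simpa using hS.fun_pow 3
    have h3 : √3 ^ 2 = 3 := Real.sq_sqrt (by norm_num)
    refine ⟨?_, ?_, ?_, ?_⟩
    · have hc := cos_ne_zero_of_mem hr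
      rw [hT r hr, hrf, hra]
      generalize √(Real.sin r) = q at *
      rw [← hsq]
      field_simp
    · refine ((hA.fun_div hS hq.ne').const_mul (σ * (3 / 4))).congr_deriv ?_
      field_simp
    · refine ((((hA'.const_mul (√3 / 2)).fun_div hS hq.ne').fun_sub
        ((hA.fun_mul (Real.hasDerivAt_cos r)).fun_div (hS3.const_mul 2)
          (by positivity))).const_mul (σ * (3 / 4))).congr_deriv ?_
      generalize √(Real.sin r) = q at *
      rw [← hsq]
      field_simp
      linear_combination -4 * σ * q ^ 4 * Real.sin (√3 * r / 2) * h3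
    · simp only [angularFactor, profile]
      rw [Real.cos_two_mul]
      have h1 := Real.sin_sq_add_cos_sq r
      generalize √(Real.sin r) = q at *
      rw [← hsq] at h1 ⊢
      field_simp
      linear_combination -12 * σ * Real.sin (√3 * r / 2) * h1
  · intro r hr h
    have := hpos r hr
    simp only [angularFactor, profile] at h
    nlinarith [pow_pos this 2]

end Third

/-! ### Behaviour at the singular points -/

section Limits

lemma tendsto_abs_div_atTop {N D : ℝ → ℝ} {R : Set ℝ} {r₀ : ℝ} (hN : ContinuousAt N r₀)
    (hN0 : N r₀ ≠ 0) (hD : ContinuousAt D r₀) (hD0 : D r₀ = 0) (hR : ∀ r ∈ R, D r ≠ 0) :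
    Tendsto (fun r => |N r / D r|) (𝓝[R] r₀) atTop := by
  have h1 : Tendsto (fun r => |D r|) (𝓝[R] r₀) (𝓝[>] 0) := by
    refine tendsto_nhdsWithin_iff.2 ⟨?_, ?_⟩
    · have := hD.abs.tendsto.mono_left (nhdsWithin_le_nhds (s := R))
      simpa [hD0] using this
    · filter_upwards [self_mem_nhdsWithin] with r hr using abs_pos.2 (hR r hr)
  have h2 := hN.abs.tendsto.mono_left (nhdsWithin_le_nhds (s := R))
  refine (h2.pos_mul_atTop (abs_pos.2 hN0) (tendsto_inv_nhdsGT_zero.comp h1)).congr ?_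
  intro r
  rw [abs_div, div_eq_mul_inv]
  rfl

lemma nhdsWithin_zero_le {R : Set ℝ} (hR : R ⊆ Ioo 0 Real.pi) : 𝓝[R] (0 : ℝ) ≤ 𝓝[>] 0 :=
  nhdsWithin_mono _ (hR.trans Ioo_subset_Ioi_self)

lemma nhdsWithin_pi_le {R : Set ℝ} (hR : R ⊆ Ioo 0 Real.pi) : 𝓝[R] Real.pi ≤ 𝓝[<] Real.pi :=
  nhdsWithin_mono _ (hR.trans Ioo_subset_Iio_self)

lemma eq_zero_or_pi_of_notMem {r : ℝ} (hr : r ∈ Icc 0 Real.pi) (h : r ∉ Ioo 0 Real.pi) :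
    r = 0 ∨ r = Real.pi := by
  by_contra! hne
  exact h ⟨lt_of_le_of_ne hr.1 hne.1.symm, lt_of_le_of_ne hr.2 hne.2⟩

lemma tendsto_factor_zero {r : ℝ} (hr : r ∈ Icc 0 Real.pi \ regularRadii 0) :
    Tendsto (factor 0) (𝓝[regularRadii 0] r) (𝓝 0) ∨
      Tendsto (factor 0) (𝓝[regularRadii 0] r) atTop := by
  let g : ℝ → ℝ := fun t => 4 * (1 + t ^ 2) * √(1 + 2 * t ^ 2) ^ 3 * t ^ 2 /
    (3 * t ^ 6 + 9 * t ^ 4 + 6 * t ^ 2 + 1)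
  have hg : ∀ r₀, (fun r => g (Real.tan (r / 2))) =ᶠ[𝓝[regularRadii 0] r₀] factor 0 := fun r₀ => by
    filter_upwards [self_mem_nhdsWithin] with q hq
      using (factor_zero_eq (regularRadii_subset 0 hq)).symm
  obtain ⟨hr, hr'⟩ := hr
  rw [regularRadii_zero] at hr'
  rcases eq_zero_or_pi_of_notMem hr hr' with rfl | rfl
  · left
    have h1 : ContinuousAt g 0 := by
      refine ContinuousAt.div (by fun_prop) (by fun_prop) (by norm_num)
    have h2 := (h1.tendsto.mono_left (nhdsWithin_le_nhds (s := Ioi 0))).comp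
      (tendsto_tan_half_zero.mono_left (nhdsWithin_zero_le (regularRadii_subset 0)))
    have h3 : g 0 = 0 := by simp [g]
    rw [h3] at h2
    exact h2.congr' (hg 0)
  · right
    have h1 : Tendsto g atTop atTop := by
      refine tendsto_atTop_mono' atTop ?_
        (tendsto_id.atTop_div_const (show (0 : ℝ) < 5 by norm_num))
      filter_upwards [eventually_ge_atTop 1] with t ht
      have ht0 : 0 < t := by linarith
      have hq : t ≤ √(1 + 2 * t ^ 2) := Real.le_sqrt_of_sq_le (by nlinarith)
      have hq3 : t ^ 3 ≤ √(1 + 2 * t ^ 2) ^ 3 := by gcongr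
      simp only [g, id]
      rw [div_le_div_iff₀ (by norm_num) (by positivity)]
      have e1 : 1 ≤ t ^ 2 := one_le_pow₀ ht
      have e2 : t ^ 2 ≤ t ^ 6 := pow_le_pow_right₀ ht (by norm_num)
      have e3 : t ^ 4 ≤ t ^ 6 := pow_le_pow_right₀ ht (by norm_num)
      calc t * (3 * t ^ 6 + 9 * t ^ 4 + 6 * t ^ 2 + 1) ≤ t * (20 * t ^ 6) := by
            gcongr
            linarith
        _ = 4 * t ^ 2 * t ^ 3 * t ^ 2 * 5 := by ring
        _ ≤ 4 * (1 + t ^ 2) * √(1 + 2 * t ^ 2) ^ 3 * t ^ 2 * 5 := by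
            gcongr
            linarith
    exact (h1.comp (tendsto_tan_half_pi.mono_left
      (nhdsWithin_pi_le (regularRadii_subset 0)))).congr' (hg _)

/-- The rational factor of `powerFactor`. -/
noncomputable def powerFactorRest (s t : ℝ) : ℝ :=
  (t ^ 2 + 7 + 4 * s) * (t ^ 2 - 2 - s) / ((1 + t ^ 2) ^ 2 * (t ^ 2 - 1))

lemma abs_powerFactor {s t : ℝ} (ht : 0 < t) :
    |powerFactor s t| = t ^ (1 + s) * |powerFactorRest s t| := by
  rw [powerFactor, powerFactorRest, mul_assoc, mul_div_assoc, abs_mul,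
    abs_of_pos (Real.rpow_pos_of_pos ht _)]

lemma tendsto_powerFactorRest_zero {s : ℝ} (hs : s ^ 2 = 3) :
    ∃ c > 0, Tendsto (fun t => |powerFactorRest s t|) (𝓝[>] 0) (𝓝 c) := by
  have h1 : ContinuousAt (powerFactorRest s) 0 :=
    ContinuousAt.div (by fun_prop) (by fun_prop) (by norm_num)
  refine ⟨|powerFactorRest s 0|, abs_pos.2 ?_, h1.abs.tendsto.mono_left nhdsWithin_le_nhds⟩
  have h2 := seven_add_pos hs
  have h3 := two_add_pos hs
  have h4 : powerFactorRest s 0 = (7 + 4 * s) * (2 + s) := by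
    simp [powerFactorRest]
    ring
  rw [h4]
  positivity

/-- In terms of `v = t⁻²` the function `t² powerFactorRest s t` is continuous at `v = 0`. -/
lemma tendsto_sq_mul_powerFactorRest_atTop (s : ℝ) :
    Tendsto (fun t => t ^ 2 * |powerFactorRest s t|) atTop (𝓝 1) := by
  let h : ℝ → ℝ := fun v => (1 + (7 + 4 * s) * v) * (1 - (2 + s) * v) / ((v + 1) ^ 2 * (1 - v))
  have h1 : ContinuousAt h 0 := ContinuousAt.div (by fun_prop) (by fun_prop) (by norm_num)
  have h2 : Tendsto (fun t : ℝ => (t ^ 2)⁻¹) atTop (𝓝 0) :=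
    (tendsto_pow_atTop two_ne_zero).inv_tendsto_atTop
  have h3 := (h1.abs.tendsto).comp h2
  have h4 : |h 0| = 1 := by simp [h]
  rw [h4] at h3
  refine h3.congr' ?_
  filter_upwards [eventually_gt_atTop 1] with t ht
  have ht0 : 0 < t := by linarith
  have ht1 : t ^ 2 - 1 ≠ 0 := by nlinarith
  rw [← abs_of_pos (pow_pos ht0 2), ← abs_mul]
  simp only [Function.comp_apply, h, powerFactorRest]
  have ht2 : 1 - (t ^ 2)⁻¹ ≠ 0 := by
    intro h
    apply ht1
    field_simp at h
    linarith
  congr 1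
  field_simp
  ring

lemma tendsto_powerFactor_pi_div_two {s : ℝ} (hs : s ^ 2 = 3) {R : Set ℝ}
    (hR1 : ∀ r ∈ R, Real.tan (r / 2) ^ 2 ≠ 1) :
    Tendsto (fun r => |powerFactor s (Real.tan (r / 2))|) (𝓝[R] (Real.pi / 2)) atTop := by
  have hr : Real.pi / 2 ∈ Ioo 0 Real.pi := ⟨by positivity, by linarith [Real.pi_pos]⟩
  have hc := (contDiffAt_tan_half hr).continuousAt
  have ht : Real.tan (Real.pi / 2 / 2) = 1 := by
    rw [div_div, show (2 : ℝ) * 2 = 4 by norm_num, Real.tan_pi_div_four]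
  have hp : ContinuousAt (fun r => Real.tan (r / 2) ^ (1 + s)) (Real.pi / 2) :=
    hc.rpow_const (Or.inl (by rw [ht]; exact one_ne_zero))
  refine tendsto_abs_div_atTop ((hp.mul (by fun_prop)).mul (by fun_prop)) ?_
    (D := fun r => (1 + Real.tan (r / 2) ^ 2) ^ 2 * (Real.tan (r / 2) ^ 2 - 1)) (by fun_prop)
    (by simp [ht]) (fun r hr => mul_ne_zero (by positivity) (sub_ne_zero.2 (hR1 r hr)))
  have h1 : -1 - s ≠ 0 := by
    intro h
    have : s = -1 := by linarith
    rw [this] at hs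
    norm_num at hs
  have h2 : 8 + 4 * s ≠ 0 := by linarith [two_add_pos hs]
  rw [ht, Real.one_rpow]
  convert! mul_ne_zero h2 h1 using 1
  ring

lemma tendsto_powerFactor_zero {s : ℝ} (hs : s ^ 2 = 3) {R : Set ℝ} :
    Tendsto (fun r => |powerFactor s (Real.tan (r / 2))|) (𝓝[R] (2 * Real.arctan √(2 + s)))
      (𝓝 0) := by
  have h2 := two_add_pos hs
  have hq := Real.sqrt_pos.2 h2
  have hr : 2 * Real.arctan √(2 + s) ∈ Ioo 0 Real.pi :=
    ⟨by have := Real.arctan_pos.2 hq; positivity, by linarith [Real.arctan_lt_pi_div_two √(2 + s)]⟩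
  have ht : Real.tan (2 * Real.arctan √(2 + s) / 2) = √(2 + s) := by
    rw [mul_div_cancel_left₀ _ two_ne_zero, Real.tan_arctan]
  have hs1 : √(2 + s) ^ 2 ≠ 1 := by
    rw [Real.sq_sqrt h2.le]
    intro h
    have : s = -1 := by linarith
    rw [this] at hs
    norm_num at hs
  have hc : ContinuousAt (fun r => |powerFactor s (Real.tan (r / 2))|)
      (2 * Real.arctan √(2 + s)) := by
    refine ContinuousAt.abs (ContinuousAt.comp (g := powerFactor s) ?_
      (contDiffAt_tan_half hr).continuousAt)
    rw [ht]
    exact (contDiffAt_powerFactor hq hs1).continuousAt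
  have h0 : |powerFactor s (Real.tan (2 * Real.arctan √(2 + s) / 2))| = 0 := by
    rw [ht, powerFactor, Real.sq_sqrt h2.le]
    simp
  have := hc.tendsto
  rw [h0] at this
  exact this.mono_left nhdsWithin_le_nhds

lemma tendsto_powerFactor_poles {s : ℝ} (hs : s ^ 2 = 3) {R : Set ℝ} (hR : R ⊆ Ioo 0 Real.pi) :
    (0 < s → Tendsto (fun r => |powerFactor s (Real.tan (r / 2))|) (𝓝[R] 0) (𝓝 0) ∧
      Tendsto (fun r => |powerFactor s (Real.tan (r / 2))|) (𝓝[R] Real.pi) atTop) ∧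
    (s < 0 → Tendsto (fun r => |powerFactor s (Real.tan (r / 2))|) (𝓝[R] 0) atTop ∧
      Tendsto (fun r => |powerFactor s (Real.tan (r / 2))|) (𝓝[R] Real.pi) (𝓝 0)) := by
  obtain ⟨c, hc, h0⟩ := tendsto_powerFactorRest_zero hs
  have h1 := tendsto_sq_mul_powerFactorRest_atTop s
  have e0 : (fun t => t ^ (1 + s) * |powerFactorRest s t|) =ᶠ[𝓝[>] 0]
      fun t => |powerFactor s t| := by
    filter_upwards [self_mem_nhdsWithin] with t ht using (abs_powerFactor ht).symm
  have e1 : (fun t => t ^ (s - 1) * (t ^ 2 * |powerFactorRest s t|)) =ᶠ[atTop]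
      fun t => |powerFactor s t| := by
    filter_upwards [eventually_gt_atTop 0] with t ht
    rw [abs_powerFactor ht, ← mul_assoc, ← Real.rpow_natCast, ← Real.rpow_add ht]
    norm_num
    left
    ring_nf
  have c0 := tendsto_tan_half_zero.mono_left (nhdsWithin_zero_le hR)
  have c1 := tendsto_tan_half_pi.mono_left (nhdsWithin_pi_le hR)
  refine ⟨fun h => ⟨?_, ?_⟩, fun h => ⟨?_, ?_⟩⟩
  · have hp : Tendsto (fun t : ℝ => t ^ (1 + s)) (𝓝[>] 0) (𝓝 0) := by
      have := (Real.continuousAt_rpow_const 0 (1 + s) (Or.inr (by linarith))).tendsto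
      rw [Real.zero_rpow (by linarith)] at this
      exact this.mono_left nhdsWithin_le_nhds
    have := hp.mul h0
    rw [zero_mul] at this
    exact (this.congr' e0).comp c0
  · have hs1 : 1 < s := by nlinarith
    exact (((tendsto_rpow_atTop (sub_pos.2 hs1)).atTop_mul_pos one_pos h1).congr' e1).comp c1
  · have hs1 : s < -1 := by nlinarith
    have hp : Tendsto (fun t : ℝ => t ^ (1 + s)) (𝓝[>] 0) atTop := by
      refine ((tendsto_rpow_atTop (show 0 < -(1 + s) by linarith)).comp
        tendsto_inv_nhdsGT_zero).congr' ?_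
      filter_upwards [self_mem_nhdsWithin] with t ht
      simp only [mem_Ioi] at ht
      simp only [Function.comp_apply]
      rw [Real.rpow_neg (by positivity), Real.inv_rpow ht.le, inv_inv]
    exact ((hp.atTop_mul_pos hc h0).congr' e0).comp c0
  · have hp : Tendsto (fun t : ℝ => t ^ (s - 1)) atTop (𝓝 0) := by
      have := tendsto_rpow_neg_atTop (show 0 < 1 - s by linarith)
      simpa using this
    have := hp.mul h1
    rw [zero_mul] at this
    exact (this.congr' e1).comp c1

lemma tendsto_powerFactor {s : ℝ} (hs : s ^ 2 = 3) {r : ℝ}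
    (hr : r ∈ Icc 0 Real.pi \ (Ioo 0 Real.pi \ {Real.pi / 2, 2 * Real.arctan √(2 + s)})) :
    Tendsto (fun r => |powerFactor s (Real.tan (r / 2))|)
        (𝓝[Ioo 0 Real.pi \ {Real.pi / 2, 2 * Real.arctan √(2 + s)}] r) (𝓝 0) ∨
      Tendsto (fun r => |powerFactor s (Real.tan (r / 2))|)
        (𝓝[Ioo 0 Real.pi \ {Real.pi / 2, 2 * Real.arctan √(2 + s)}] r) atTop := by
  obtain ⟨hr, hr'⟩ := hr
  by_cases h : r ∈ Ioo 0 Real.pi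
  · have h2 : r ∈ ({Real.pi / 2, 2 * Real.arctan √(2 + s)} : Set ℝ) := by
      by_contra h3
      exact hr' ⟨h, h3⟩
    rcases h2 with rfl | h2
    · refine Or.inr (tendsto_powerFactor_pi_div_two hs fun q hq => tan_half_sq_ne hq.1 ?_)
      rw [two_arctan_one]
      exact fun h => hq.2 (Or.inl h)
    · rw [mem_singleton_iff.1 h2]
      exact Or.inl (tendsto_powerFactor_zero hs)
  · have hp := tendsto_powerFactor_poles hs (sdiff_subset :
      Ioo 0 Real.pi \ {Real.pi / 2, 2 * Real.arctan √(2 + s)} ⊆ Ioo 0 Real.pi)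
    have hs0 : s ≠ 0 := by
      rintro rfl
      norm_num at hs
    rcases eq_zero_or_pi_of_notMem hr h with rfl | rfl <;> rcases hs0.lt_or_gt with h0 | h0
    · exact Or.inr (hp.2 h0).1
    · exact Or.inl (hp.1 h0).1
    · exact Or.inl (hp.2 h0).2
    · exact Or.inr (hp.1 h0).2

lemma tendsto_factor_three {r : ℝ} (hr : r ∈ Icc 0 Real.pi \ regularRadii 3) :
    Tendsto (factor 3) (𝓝[regularRadii 3] r) (𝓝 0) ∨
      Tendsto (factor 3) (𝓝[regularRadii 3] r) atTop := by
  obtain ⟨hr, hr'⟩ := hr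
  have hE : (fun r => |√(Real.sin r) * Real.sin (√3 / 2 * r) / Real.cos r|)
      =ᶠ[𝓝[regularRadii 3] r] factor 3 := by
    filter_upwards [self_mem_nhdsWithin] with q hq
      using (factor_three q (Ioo_subset_Icc_self (regularRadii_subset 3 hq))).symm
  by_cases h : r ∈ Ioo 0 Real.pi
  · have h2 : r = Real.pi / 2 := by
      by_contra h3
      exact hr' ⟨h, h3⟩
    right
    subst h2
    refine (tendsto_abs_div_atTop (by fun_prop) ?_ (by fun_prop) Real.cos_pi_div_two
      (fun q hq => cos_ne_zero_of_mem hq)).congr' hE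
    rw [Real.sin_pi_div_two, Real.sqrt_one, one_mul]
    exact (sin_sqrt_three_pos h).ne'
  · left
    have hsc : Real.sin r = 0 ∧ Real.cos r ≠ 0 := by
      rcases eq_zero_or_pi_of_notMem hr h with rfl | rfl <;> simp
    have hc : ContinuousAt (fun r => |√(Real.sin r) * Real.sin (√3 / 2 * r) / Real.cos r|) r :=
      (ContinuousAt.div (by fun_prop) (by fun_prop) hsc.2).abs
    have h1 := hc.tendsto.mono_left (nhdsWithin_le_nhds (s := regularRadii 3))
    simp only [hsc.1, Real.sqrt_zero, zero_mul, zero_div, abs_zero] at h1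
    exact h1.congr' hE

end Limits

/-! ### The four maps -/

section Conclusion

lemma exists_isBiharmonicProfile (k : Fin 4) : ∃ ρ₁ ρ₂ : ℝ → ℝ,
    IsBiharmonicProfile (factor k) (profile k) ρ₁ ρ₂ (angularFactor k) (regularRadii k) := by
  have h3 : √3 ^ 2 = (3 : ℝ) := Real.sq_sqrt (by norm_num)
  have h3' : (-√3) ^ 2 = (3 : ℝ) := by rw [neg_sq, h3]
  have key : ∀ {k : Fin 4} {s : ℝ}, singularRadii k =
      {Real.pi / 2, 2 * Real.arctan √(2 + s)} → ∀ r ∈ regularRadii k,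
      Real.tan (r / 2) ^ 2 ≠ 1 ∧ Real.tan (r / 2) ^ 2 ≠ 2 + s := by
    intro k s h r hr
    rw [regularRadii, h] at hr
    refine ⟨tan_half_sq_ne hr.1 ?_, tan_half_sq_ne hr.1 fun h => hr.2 (Or.inr h)⟩
    rw [two_arctan_one]
    exact fun h => hr.2 (Or.inl h)
  match k with
  | 0 => exact ⟨_, _, isBiharmonicProfile_zero⟩
  | 1 =>
    have hk : singularRadii 1 = {Real.pi / 2, 2 * Real.arctan √(2 + √3)} := rfl
    exact ⟨_, _, isBiharmonicProfile_power h3 h3 (isOpen_regularRadii 1) (regularRadii_subset 1)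
      (fun r hr => (key hk r hr).1) (fun r hr => (key hk r hr).2)⟩
  | 2 =>
    have hk : singularRadii 2 = {Real.pi / 2, 2 * Real.arctan √(2 + -√3)} := by
      rw [← sub_eq_add_neg]
      rfl
    rw [funext factor_two]
    exact ⟨_, _, isBiharmonicProfile_power h3' h3' (isOpen_regularRadii 2)
      (regularRadii_subset 2) (fun r hr => (key hk r hr).1) (fun r hr => (key hk r hr).2)⟩
  | 3 => exact ⟨_, _, isBiharmonicProfile_three⟩

lemma tendsto_factor (k : Fin 4) {r : ℝ} (hr : r ∈ Icc 0 Real.pi \ regularRadii k) :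
    Tendsto (factor k) (𝓝[regularRadii k] r) (𝓝 0) ∨
      Tendsto (factor k) (𝓝[regularRadii k] r) atTop := by
  have h3 : √3 ^ 2 = (3 : ℝ) := Real.sq_sqrt (by norm_num)
  have h3' : (-√3) ^ 2 = (3 : ℝ) := by rw [neg_sq, h3]
  match k with
  | 0 => exact tendsto_factor_zero hr
  | 1 => exact tendsto_powerFactor h3 hr
  | 2 =>
    have hk : regularRadii 2 =
        Ioo 0 Real.pi \ {Real.pi / 2, 2 * Real.arctan √(2 + -√3)} := by
      rw [← sub_eq_add_neg]
      rfl
    rw [hk] at hr ⊢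
    rw [funext factor_two]
    exact tendsto_powerFactor h3' hr
  | 3 => exact tendsto_factor_three hr

end Conclusion

end SphereMaps

open SphereMaps
theorem corollary3p10 (n : ℕ) (hn : 3 ≤ n) (k : Fin 4) :
    -- `fₖ⁻¹ g₀` is a smooth Riemannian metric off the singular points
    ContDiffOn ℝ ∞ (factor k) (regularRadii k) ∧
    (∀ r ∈ regularRadii k, 0 < factor k r) ∧
    -- the remaining points of the sphere are singular points of `fₖ⁻¹ g₀`
    (∀ r ∈ Icc 0 Real.pi \ regularRadii k,
      Tendsto (factor k) (𝓝[regularRadii k] r) (𝓝 0) ∨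
        Tendsto (factor k) (𝓝[regularRadii k] r) atTop) ∧
    -- on every open set of regular points on which `φₖ` is defined, `I ∘ φₖ` is proper biharmonic
    -- and not weakly conformal
    ∀ (U : Set (Sph 2)) (θ : Sph 2 → ℝ), IsOpen U → U.Nonempty →
      (∀ p ∈ U, colat p ∈ regularRadii k) →
      (∀ p ∈ U, polar (colat p) (θ p) = p) →
      (k = 0 ∨ ContinuousOn θ U) →
      IsProperBiharmonicOn (conformalMetric (factor k)) (stdEmbedding n hn ∘ rotMap k θ) U ∧
      ¬ IsWeaklyConformalOn (conformalMetric (factor k)) (stdEmbedding n hn ∘ rotMap k θ) U := by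
  obtain ⟨ρ₁, ρ₂, h⟩ := exists_isBiharmonicProfile k
  refine ⟨h.contDiffOn_factor, h.factor_pos, fun r hr => tendsto_factor k hr, ?_⟩
  intro U θ hU hne hUR hθ hk
  exact h.isProperBiharmonicOn n hn hne
    fun p hp => exists_isRotationalOn_rotMap k h.subset hU hUR hθ hk hp
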